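/- Let $\Omega\subseteq\mathbb R^p$ be open. For open $\omega\subseteq\mathbb R^p$ let $\mathcal G(\omega)=\mathcal E_M(\omega)/\mathcal N(\omega)$ be the (special) Colombeau algebra: $\mathcal E_M(\omega)$ consists of the families $(u_\varepsilon)_{\varepsilon\in(0,1]}$ in $\mathcal C^\infty(\omega)$ such that for all compact $K\subset\omega$ and all $\alpha$ there is $N\in\mathbb N$ with $\sup_K|\partial^\alpha u_\varepsilon|=O(\varepsilon^{-N})$ as $\varepsilon\to0$, and $\mathcal N(\omega)$ of those with $\sup_K|\partial^\alpha u_\varepsilon|=O(\varepsilon^{m})$ for all $K$, $\alpha$ and all $m\in\mathbb N$. Let $\Delta_\nu(x,u^{(n)})=0$, $\nu=1,\dots,l$, be a system of $l$ linear (homogeneous) PDEs of order at most $n$ for $u=(u_1,\dots,u_l)$ on $\mathbb R^p$: $\Delta(x,\cdot)$ is linear in the jet variables $u^{(n)}=(\partial^\alpha u_j)_{1\le j\le l,\,|\alpha|\le n}$, and $\Delta=(\Delta_1,\dots,\Delta_l)$ is slowly increasing, that is, smooth with each derivative bounded by $C(1+|(x,u^{(n)})|)^N$ for some $C,N$ depending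 on the derivative. Assume that the operator $f\mapsto\Delta(\cdot,\mathrm{pr}^{(n)}f)$, where $\mathrm{pr}^{(n)}f=(\partial^\alpha f_j)_{j,\,|\alpha|\le n}$, maps $(\mathcal C^\infty(\Omega))^l$ onto $(\mathcal C^\infty(\Omega))^l$. Let $\eta\mapsto g_\eta$, $g_\eta\cdot(x,u)=(\Xi_\eta(x),\Phi_\eta(x,u))$, be a projectable local one-parameter group of transformations acting smoothly on an open set $M\subseteq\mathbb R^p\times\mathbb R^l$. Assume that it is slowly increasing: for every $\eta$, every compact set $K$ in the domain of $\Xi_\eta$, and every order $k$ there are $C,N$ such that all derivatives of order $k$ of $\Phi_\eta$ with respect to $(x,u)$ are bounded by $C(1+|u|)^N$ at all points $(x,u)$ of the domain of $g_\eta$ with $x\in K$. Assume also that it is a classical symmetry group of the system: whenever $f$ is a smooth solution on an open set $\Omega'\subseteq\mathbb R^p$ whose graph lies in the domain of $g_\eta$, the function $g_\eta f=(\Phi_\eta\circ(\mathrm{id}\times f))\circ\Xi_\eta^{-1}$ is a smooth solution on $\Xi_\eta(\Omega')$. Then $\eta\mapsto g_\eta$ is a symmetry group of the system in $\mathcal G(\Omega)$: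 for every $\eta$ such that $g_\eta$ is defined on all of $\Omega\times\mathbb R^l$ and for every $U\in(\mathcal G(\Omega))^l$ with $\Delta(x,\mathrm{pr}^{(n)}U)=0$ in $(\mathcal G(\Omega))^l$, the generalized function $g_\eta U=\mathrm{cl}[(g_\eta u_\varepsilon)_\varepsilon]\in(\mathcal G(\Xi_\eta(\Omega)))^l$ is well defined, independently of the representative $(u_\varepsilon)_\varepsilon$ of $U$, and satisfies $\Delta(x,\mathrm{pr}^{(n)}(g_\eta U))=0$ in $(\mathcal G(\Xi_\eta(\Omega)))^l$. -/

import Mathlib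

open scoped ContDiff

noncomputable section

namespace Colombeau

/-- The space `ℝᵈ` with its Euclidean norm: independent variables for `d = p`, dependent variables
for `d = q`. -/
abbrev Space (d : ℕ) : Type := EuclideanSpace ℝ (Fin d)

/-- The index set `I = (0, 1]` of the regularization parameter. -/
abbrev Param : Type := Set.Ioc (0 : ℝ) 1

section Algebra

variable {p : ℕ} {F : Type*} [NormedAddCommGroup F] [NormedSpace ℝ F]

/-- The moderate families `(u_ε)` of smooth `F`-valued functions on `Ω`. A smooth function on the
open set `Ω` is represented by a total function that is smooth on `Ω`; its values outside `Ω` are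
irrelevant and are identified in the quotient below. The bounds on all partial derivatives of
order `k` are written as a bound on the `k`-th total derivative. For `F = ℝ^q` this is
`(E_M(Ω))^q`. -/
def IsModerate (Ω : Set (Space p)) (u : Param → Space p → F) : Prop :=
  (∀ ε, ContDiffOn ℝ ∞ (u ε) Ω) ∧
    ∀ K : Set (Space p), IsCompact K → K ⊆ Ω → ∀ k : ℕ, ∃ N : ℕ, ∃ C : ℝ, ∃ ε₀ : ℝ, 0 < ε₀ ∧
      ∀ ε : Param, (ε : ℝ) < ε₀ → ∀ x ∈ K,
        ‖iteratedFDeriv ℝ k (u ε) x‖ ≤ C * ((ε : ℝ)⁻¹) ^ N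

/-- The negligible families `(u_ε)` of smooth `F`-valued functions on `Ω`. -/
def IsNegligible (Ω : Set (Space p)) (u : Param → Space p → F) : Prop :=
  (∀ ε, ContDiffOn ℝ ∞ (u ε) Ω) ∧
    ∀ K : Set (Space p), IsCompact K → K ⊆ Ω → ∀ k m : ℕ, ∃ C : ℝ, ∃ ε₀ : ℝ, 0 < ε₀ ∧
      ∀ ε : Param, (ε : ℝ) < ε₀ → ∀ x ∈ K,
        ‖iteratedFDeriv ℝ k (u ε) x‖ ≤ C * (ε : ℝ) ^ m

theorem norm_iteratedFDeriv_add_le {Ω : Set (Space p)} (hΩ : IsOpen Ω) {f g : Space p → F}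
    (hf : ContDiffOn ℝ ∞ f Ω) (hg : ContDiffOn ℝ ∞ g Ω) {x : Space p} (hx : x ∈ Ω) (k : ℕ) :
    ‖iteratedFDeriv ℝ k (f + g) x‖ ≤ ‖iteratedFDeriv ℝ k f x‖ + ‖iteratedFDeriv ℝ k g x‖ := by
  have hf' : ContDiffAt ℝ k f x :=
    (hf.contDiffAt (hΩ.mem_nhds hx)).of_le (by exact_mod_cast le_top)
  have hg' : ContDiffAt ℝ k g x :=
    (hg.contDiffAt (hΩ.mem_nhds hx)).of_le (by exact_mod_cast le_top)
  rw [iteratedFDeriv_add_apply hf' hg']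
  exact norm_add_le _ _

theorem norm_iteratedFDeriv_smul_eq {Ω : Set (Space p)} (hΩ : IsOpen Ω) {f : Space p → F}
    (hf : ContDiffOn ℝ ∞ f Ω) {x : Space p} (hx : x ∈ Ω) (k : ℕ) (c : ℝ) :
    ‖iteratedFDeriv ℝ k (c • f) x‖ = ‖c‖ * ‖iteratedFDeriv ℝ k f x‖ := by
  have hf' : ContDiffAt ℝ k f x :=
    (hf.contDiffAt (hΩ.mem_nhds hx)).of_le (by exact_mod_cast le_top)
  rw [iteratedFDeriv_const_smul_apply hf', norm_smul]

variable (F)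

/-- The space `E_M(Ω; F)` of moderate families. -/
def moderate (Ω : TopologicalSpace.Opens (Space p)) : Submodule ℝ (Param → Space p → F) where
  carrier := {u | IsModerate (Ω : Set (Space p)) u}
  zero_mem' := by
    refine ⟨fun ε => contDiffOn_const, fun K _ _ k => ⟨0, 0, 1, one_pos, fun ε _ x _ => ?_⟩⟩
    simp
  add_mem' := by
    rintro u v ⟨hu, hu'⟩ ⟨hv, hv'⟩
    refine ⟨fun ε => (hu ε).add (hv ε), fun K hK hKΩ k => ?_⟩
    obtain ⟨N, C, a, ha, h⟩ := hu' K hK hKΩ k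
    obtain ⟨N', C', a', ha', h'⟩ := hv' K hK hKΩ k
    refine ⟨N + N', |C| + |C'|, min a a', lt_min ha ha', fun ε hε x hx => ?_⟩
    have h1 := h ε (hε.trans_le (min_le_left _ _)) x hx
    have h2 := h' ε (hε.trans_le (min_le_right _ _)) x hx
    have h0 : 1 ≤ (ε : ℝ)⁻¹ := (one_le_inv₀ ε.2.1).2 ε.2.2
    have e1 : ((ε : ℝ)⁻¹) ^ N ≤ ((ε : ℝ)⁻¹) ^ (N + N') := pow_le_pow_right₀ h0 (by omega)
    have e2 : ((ε : ℝ)⁻¹) ^ N' ≤ ((ε : ℝ)⁻¹) ^ (N + N') := pow_le_pow_right₀ h0 (by omega)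
    have p1 : 0 ≤ ((ε : ℝ)⁻¹) ^ N := by positivity
    have p2 : 0 ≤ ((ε : ℝ)⁻¹) ^ N' := by positivity
    calc ‖iteratedFDeriv ℝ k ((u + v) ε) x‖
        ≤ ‖iteratedFDeriv ℝ k (u ε) x‖ + ‖iteratedFDeriv ℝ k (v ε) x‖ :=
          norm_iteratedFDeriv_add_le Ω.isOpen (hu ε) (hv ε) (hKΩ hx) k
      _ ≤ C * ((ε : ℝ)⁻¹) ^ N + C' * ((ε : ℝ)⁻¹) ^ N' := add_le_add h1 h2
      _ ≤ |C| * ((ε : ℝ)⁻¹) ^ (N + N') + |C'| * ((ε : ℝ)⁻¹) ^ (N + N') := by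
          refine add_le_add ?_ ?_
          · exact mul_le_mul (le_abs_self C) e1 p1 (abs_nonneg C)
          · exact mul_le_mul (le_abs_self C') e2 p2 (abs_nonneg C')
      _ = (|C| + |C'|) * ((ε : ℝ)⁻¹) ^ (N + N') := by ring
  smul_mem' := by
    rintro c u ⟨hu, hu'⟩
    refine ⟨fun ε => contDiffOn_const.smul (hu ε), fun K hK hKΩ k => ?_⟩
    obtain ⟨N, C, a, ha, h⟩ := hu' K hK hKΩ k
    refine ⟨N, ‖c‖ * C, a, ha, fun ε hε x hx => ?_⟩
    have e := norm_iteratedFDeriv_smul_eq Ω.isOpen (hu ε) (hKΩ hx) k c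
    rw [Pi.smul_apply, e, mul_assoc]
    exact mul_le_mul_of_nonneg_left (h ε hε x hx) (norm_nonneg c)

/-- The space `N(Ω; F)` of negligible families. -/
def negligible (Ω : TopologicalSpace.Opens (Space p)) : Submodule ℝ (Param → Space p → F) where
  carrier := {u | IsNegligible (Ω : Set (Space p)) u}
  zero_mem' := by
    refine ⟨fun ε => contDiffOn_const, fun K _ _ k m => ⟨0, 1, one_pos, fun ε _ x _ => ?_⟩⟩
    simp
  add_mem' := by
    rintro u v ⟨hu, hu'⟩ ⟨hv, hv'⟩
    refine ⟨fun ε => (hu ε).add (hv ε), fun K hK hKΩ k m => ?_⟩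
    obtain ⟨C, a, ha, h⟩ := hu' K hK hKΩ k m
    obtain ⟨C', a', ha', h'⟩ := hv' K hK hKΩ k m
    refine ⟨C + C', min a a', lt_min ha ha', fun ε hε x hx => ?_⟩
    have h1 := h ε (hε.trans_le (min_le_left _ _)) x hx
    have h2 := h' ε (hε.trans_le (min_le_right _ _)) x hx
    calc ‖iteratedFDeriv ℝ k ((u + v) ε) x‖
        ≤ ‖iteratedFDeriv ℝ k (u ε) x‖ + ‖iteratedFDeriv ℝ k (v ε) x‖ :=
          norm_iteratedFDeriv_add_le Ω.isOpen (hu ε) (hv ε) (hKΩ hx) k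
      _ ≤ C * (ε : ℝ) ^ m + C' * (ε : ℝ) ^ m := add_le_add h1 h2
      _ = (C + C') * (ε : ℝ) ^ m := by ring
  smul_mem' := by
    rintro c u ⟨hu, hu'⟩
    refine ⟨fun ε => contDiffOn_const.smul (hu ε), fun K hK hKΩ k m => ?_⟩
    obtain ⟨C, a, ha, h⟩ := hu' K hK hKΩ k m
    refine ⟨‖c‖ * C, a, ha, fun ε hε x hx => ?_⟩
    have e := norm_iteratedFDeriv_smul_eq Ω.isOpen (hu ε) (hKΩ hx) k c
    rw [Pi.smul_apply, e, mul_assoc]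
    exact mul_le_mul_of_nonneg_left (h ε hε x hx) (norm_nonneg c)

/-- Colombeau generalized functions on `Ω` with values in `F`: moderate families modulo negligible
ones. For `F = ℝ^q` this is `(G(Ω))^q`. -/
abbrev GenFun (Ω : TopologicalSpace.Opens (Space p)) : Type _ :=
  moderate F Ω ⧸ (negligible F Ω).comap (moderate F Ω).subtype

variable {F}

/-- The class `cl[(u_ε)]` of a moderate family. -/
def cl {Ω : TopologicalSpace.Opens (Space p)} (u : moderate F Ω) : GenFun F Ω :=
  Submodule.Quotient.mk u

/-- `V` is the well-defined result of applying the operation `T` on functions componentwise to the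
generalized function `U`: for every representative `(u_ε)` of `U` the family `(T u_ε)` is moderate
and its class is `V`. -/
def IsComponentwise {F' : Type*} [NormedAddCommGroup F'] [NormedSpace ℝ F']
    {Ω Ω' : TopologicalSpace.Opens (Space p)} (T : (Space p → F) → (Space p → F'))
    (U : GenFun F Ω) (V : GenFun F' Ω') : Prop :=
  ∀ u : moderate F Ω, cl u = U →
    ∃ h : (fun ε => T ((u : Param → Space p → F) ε)) ∈ moderate F' Ω', cl ⟨_, h⟩ = V

end Algebra

section Equations

variable {p q l n : ℕ}

/-- Multi-indices `α` in `p` variables with `|α| ≤ n`. -/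
abbrev MultiIndex (p n : ℕ) : Type := {α : Fin p → Fin (n + 1) // ∑ i, (α i : ℕ) ≤ n}

/-- The list of directions of `∂^α`: each index `i` occurs `α i` times. -/
def MultiIndex.directions (α : MultiIndex p n) : List (Fin p) :=
  (List.finRange p).flatMap fun i => List.replicate (α.1 i : ℕ) i

/-- The partial derivative `∂^α f (x)`. -/
def partialDeriv {F : Type*} [NormedAddCommGroup F] [NormedSpace ℝ F]
    (α : MultiIndex p n) (f : Space p → F) (x : Space p) : F :=
  iteratedFDeriv ℝ α.directions.length f x
    fun k => EuclideanSpace.single (α.directions.get k) (1 : ℝ)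

/-- The space `U^(n)` of the coordinates `u^j_α`, `1 ≤ j ≤ q`, `|α| ≤ n`. -/
abbrev JetSpace (p q n : ℕ) : Type := EuclideanSpace ℝ (Fin q × MultiIndex p n)

/-- The prolongation `pr^(n) f (x)`. -/
def prolong (n : ℕ) (f : Space p → Space q) (x : Space p) : JetSpace p q n :=
  WithLp.toLp 2 fun a => partialDeriv a.2 f x a.1

/-- The operator `f ↦ Δ(·, pr^(n) f(·))` given by the left-hand side of a system of `l` equations
of order `n`. -/
def diffOp (Δ : Space p → JetSpace p q n → Space l) (f : Space p → Space q) :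
    Space p → Space l :=
  fun x => Δ x (prolong n f x)

/-- `f` is a classical (smooth) solution of the system on `Ω`. -/
def IsClassicalSolution (Δ : Space p → JetSpace p q n → Space l) (Ω : Set (Space p))
    (f : Space p → Space q) : Prop :=
  ContDiffOn ℝ ∞ f Ω ∧ ∀ x ∈ Ω, diffOp Δ f x = 0

/-- `U` is a solution of the system in `G(Ω)`: the system holds with equality in `(G(Ω))^l`. -/
def IsGenSolution (Δ : Space p → JetSpace p q n → Space l)
    {Ω : TopologicalSpace.Opens (Space p)} (U : GenFun (Space q) Ω) : Prop :=
  IsComponentwise (diffOp Δ) U (0 : GenFun (Space l) Ω)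

end Equations

/-- A projectable local one-parameter group of transformations
`g_η · (x, u) = (Ξ_η(x), Φ_η(x, u))` acting on an open subset `M` of the space of independent and
dependent variables; `dom` is the set of all `(η, (x, u))` for which `g_η · (x, u)` is defined. -/
structure TransformationGroup (p q : ℕ) where
  M : Set (Space p × Space q)
  dom : Set (ℝ × (Space p × Space q))
  Ξ : ℝ → Space p → Space p
  Φ : ℝ → Space p → Space q → Space q
  isOpen_M : IsOpen M
  isOpen_dom : IsOpen dom
  mem_M : ∀ {η z}, (η, z) ∈ dom → z ∈ M
  act_mem_M : ∀ {η z}, (η, z) ∈ dom → (Ξ η z.1, Φ η z.1 z.2) ∈ M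
  smooth : ContDiffOn ℝ ∞
    (fun w : ℝ × (Space p × Space q) => (Ξ w.1 w.2.1, Φ w.1 w.2.1 w.2.2)) dom
  zero_mem : ∀ {z}, z ∈ M → ((0 : ℝ), z) ∈ dom
  act_zero : ∀ {z}, z ∈ M → (Ξ 0 z.1, Φ 0 z.1 z.2) = z
  act_add : ∀ {η θ z}, (θ, z) ∈ dom → (η, (Ξ θ z.1, Φ θ z.1 z.2)) ∈ dom → (η + θ, z) ∈ dom →
    (Ξ η (Ξ θ z.1), Φ η (Ξ θ z.1) (Φ θ z.1 z.2)) = (Ξ (η + θ) z.1, Φ (η + θ) z.1 z.2)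
  neg_mem : ∀ {η z}, (η, z) ∈ dom → (-η, (Ξ η z.1, Φ η z.1 z.2)) ∈ dom
  act_neg : ∀ {η z}, (η, z) ∈ dom →
    (Ξ (-η) (Ξ η z.1), Φ (-η) (Ξ η z.1) (Φ η z.1 z.2)) = z

namespace TransformationGroup

variable {p q l n : ℕ} (G : TransformationGroup p q)

/-- Every `g_η` is slowly increasing: `u ↦ Φ_η(x, u)` is slowly increasing, uniformly for `x` in
compact sets. As for every space of smooth functions here, all derivatives of `Φ_η` as a function
of `(x, u)` are meant. The compact sets range over those in the domain of `Ξ_η`. -/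
def SlowlyIncreasing : Prop :=
  ∀ η : ℝ, ∀ K : Set (Space p), IsCompact K → (∀ x ∈ K, ∃ u, (η, (x, u)) ∈ G.dom) →
    ∀ k : ℕ, ∃ N : ℕ, ∃ C : ℝ, ∀ x ∈ K, ∀ u : Space q, (η, (x, u)) ∈ G.dom →
      ‖iteratedFDeriv ℝ k (fun z : Space p × Space q => G.Φ η z.1 z.2) (x, u)‖
        ≤ C * (1 + ‖u‖) ^ N

/-- The action on functions, `g_η f = (Φ_η ∘ (id × f)) ∘ Ξ_η⁻¹`. By the group law the inverse of
`Ξ_η` is `Ξ_{-η}`. -/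
def actFun (η : ℝ) (f : Space p → Space q) : Space p → Space q :=
  fun y => G.Φ η (G.Ξ (-η) y) (f (G.Ξ (-η) y))

/-- `G` is a (classical) symmetry group of the system: whenever `f` is a smooth solution on some
open set and `g_η f` is defined, `g_η f` is again a solution. -/
def IsClassicalSymmetryGroup (Δ : Space p → JetSpace p q n → Space l) : Prop :=
  ∀ (η : ℝ) (Ω : Set (Space p)) (f : Space p → Space q), IsOpen Ω →
    IsClassicalSolution Δ Ω f → (∀ x ∈ Ω, (η, (x, f x)) ∈ G.dom) →
      IsClassicalSolution Δ (G.Ξ η '' Ω) (G.actFun η f)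

/-- The composition `Φ_η ∘ (id × u_ε)` makes sense for all moderate families on `Ω`, that is,
`g_η` is defined on all of `Ω × ℝ^q`. -/
def ActsOver (η : ℝ) (Ω : Set (Space p)) : Prop :=
  ∀ x ∈ Ω, ∀ u : Space q, (η, (x, u)) ∈ G.dom

variable {G} in
theorem isOpen_image {η : ℝ} {Ω : Set (Space p)} (hΩ : IsOpen Ω) (h : G.ActsOver η Ω) :
    IsOpen (G.Ξ η '' Ω) := by
  rw [isOpen_iff_mem_nhds]
  rintro _ ⟨x, hx, rfl⟩
  set y := G.Ξ η x with hy
  set v := G.Φ η x 0 with hv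
  have hd : (-η, (y, v)) ∈ G.dom := G.neg_mem (h x hx 0)
  have hinv : G.Ξ (-η) y = x := congrArg Prod.fst (G.act_neg (h x hx 0))
  have hc : ContinuousAt (fun w : ℝ × (Space p × Space q) =>
      (G.Ξ w.1 w.2.1, G.Φ w.1 w.2.1 w.2.2)) (-η, (y, v)) :=
    G.smooth.continuousOn.continuousAt (G.isOpen_dom.mem_nhds hd)
  have hi : Continuous (fun t : Space p => ((-η, (t, v)) : ℝ × (Space p × Space q))) := by
    fun_prop
  have hc' : ContinuousAt (fun t : Space p => G.Ξ (-η) t) y :=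
    (ContinuousAt.comp (f := fun t : Space p => ((-η, (t, v)) : ℝ × (Space p × Space q)))
      (x := y) hc hi.continuousAt).fst
  have h1 : ∀ᶠ t in nhds y, G.Ξ (-η) t ∈ Ω :=
    hc'.eventually_mem (by rw [hinv]; exact hΩ.mem_nhds hx)
  have h2 : ∀ᶠ t in nhds y, ((-η, (t, v)) : ℝ × (Space p × Space q)) ∈ G.dom :=
    hi.continuousAt.eventually_mem (G.isOpen_dom.mem_nhds hd)
  filter_upwards [h1, h2] with t ht1 ht2
  refine ⟨G.Ξ (-η) t, ht1, ?_⟩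
  have := congrArg Prod.fst (G.act_neg ht2)
  simpa using this

/-- The open set `Ξ_η(Ω)`. -/
def image {η : ℝ} {Ω : TopologicalSpace.Opens (Space p)} (h : G.ActsOver η Ω) :
    TopologicalSpace.Opens (Space p) :=
  ⟨G.Ξ η '' Ω, isOpen_image Ω.isOpen h⟩

/-- `G` is a symmetry group of the system in `G(Ω)`: whenever `U ∈ (G(Ω))^q` is a solution and
`g_η U` is defined, the class `g_η U = cl[(g_η u_ε)]` in `(G(Ξ_η(Ω)))^q` is again a solution. -/
def IsGenSymmetryGroup (Δ : Space p → JetSpace p q n → Space l)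
    (Ω : TopologicalSpace.Opens (Space p)) : Prop :=
  ∀ (η : ℝ) (h : G.ActsOver η Ω) (U : GenFun (Space q) Ω), IsGenSolution Δ U →
    ∃ V : GenFun (Space q) (G.image h), IsComponentwise (G.actFun η) U V ∧ IsGenSolution Δ V

end TransformationGroup

end Colombeau

end

noncomputable section

namespace Colombeau

open Filter Topology Set Pointwise

/-! A representative of a generalized solution satisfies the system only up to a negligible error,
while the symmetry hypothesis speaks of exact solutions. The remedy is to choose a better
representative. The operator is linear and onto on `C^∞(Ω)`, a Fréchet space, so by the open mapping
theorem small right-hand sides have small preimages; hence a negligible error `Δ u_ε` equals `Δ m_ε`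
for some negligible `m_ε` (`exists_negligible_diffOp_eq`). By linearity `u_ε - m_ε` is a
representative of the same class made of classical solutions, and `g_η` maps each of them to a
classical solution on `Ξ_η(Ω)`.

What passes from functions to families is the lift of rapidly decreasing families through an open
linear surjection (`IsRapidlyDecreasing.exists_lift`). The open mapping theorem is applied to the
projection from the closed graph of the operator, so the continuity of the operator itself is never
needed.

Independence of representatives, for `g_η` as for `Δ`, rests on slow increase: composition preserves
moderateness, and by the mean value theorem it turns negligible differences into negligible ones
(`SlowlyIncreasingOn.isNegligible_comp_sub`). Only order zero has to be estimated there, since for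
moderate families the higher orders follow by interpolation (`IsModerate.isNegligible`). -/

theorem _root_.Submodule.isUniformAddGroup {X : Type*} [AddCommGroup X] [Module ℝ X]
    [UniformSpace X] [IsUniformAddGroup X] (S : Submodule ℝ X) : IsUniformAddGroup S :=
  inferInstanceAs (IsUniformAddGroup S.toAddSubgroup)

/-! ### Open mapping theorem -/

section OpenMapping

variable {X Y : Type*} [AddCommGroup X] [Module ℝ X] [UniformSpace X] [IsUniformAddGroup X]
  [ContinuousSMul ℝ X] [AddCommGroup Y] [Module ℝ Y] [TopologicalSpace Y]
  [IsTopologicalAddGroup Y] [ContinuousSMul ℝ Y]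

/-- With `V - V ⊆ U`, the dilates of `closure (T '' V)` cover `Y`, so by Baire one of them, hence
`closure (T '' V)` itself, has an interior point. Subtracting that point moves the interior to a
neighbourhood of zero inside `closure (T '' U)`. -/
theorem closure_image_mem_nhds_zero [BaireSpace Y] (T : X →L[ℝ] Y)
    (hT : Function.Surjective T) {U : Set X} (hU : U ∈ 𝓝 (0 : X)) :
    closure (T '' U) ∈ 𝓝 (0 : Y) := by
  obtain ⟨V, hV, hVU⟩ := exists_nhds_half_neg hU
  have hcl : ∀ n : ℕ, IsClosed (((n : ℝ) + 1) • closure (T '' V)) := fun n =>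
    isClosed_closure.smul_of_ne_zero (by positivity)
  have hun : ⋃ n : ℕ, ((n : ℝ) + 1) • closure (T '' V) = univ := by
    refine eq_univ_of_forall fun y => ?_
    obtain ⟨x, rfl⟩ := hT y
    have h0 : Tendsto (fun n : ℕ => ((n : ℝ) + 1)⁻¹ • x) atTop (𝓝 ((0 : ℝ) • x)) :=
      (tendsto_inv_atTop_zero.comp
        (tendsto_atTop_add_const_right _ _ tendsto_natCast_atTop_atTop)).smul_const x
    rw [zero_smul] at h0
    obtain ⟨n, hn⟩ := (h0.eventually hV).exists
    refine mem_iUnion.2 ⟨n, ?_⟩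
    have hn0 : (n : ℝ) + 1 ≠ 0 := by positivity
    rw [mem_smul_set_iff_inv_smul_mem₀ hn0, ← map_smul]
    exact subset_closure (mem_image_of_mem _ hn)
  obtain ⟨n, hn⟩ := nonempty_interior_of_iUnion_of_closed hcl hun
  have hn0 : (n : ℝ) + 1 ≠ 0 := by positivity
  rw [interior_smul₀ hn0] at hn
  obtain ⟨_, y, hy, -⟩ := hn
  have hmem : (fun z => z + y) ⁻¹' interior (closure (T '' V)) ∈ 𝓝 (0 : Y) :=
    (continuous_add_const y).continuousAt.preimage_mem_nhds
      (by simpa using isOpen_interior.mem_nhds hy)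
  refine mem_of_superset hmem fun z hz => ?_
  have hz' := interior_subset (mem_preimage.1 hz)
  have hy' := interior_subset hy
  have := map_mem_closure₂ (f := fun a b : Y => a - b) continuous_sub hz' hy'
    (u := T '' U) (by
      rintro _ ⟨a, ha, rfl⟩ _ ⟨b, hb, rfl⟩
      exact ⟨a - b, hVU a ha b hb, map_sub T a b⟩)
  simpa using this

/-- The open mapping theorem for a complete first countable topological vector space and a Baire
topological vector space. -/
theorem image_mem_nhds_zero [CompleteSpace X] [FirstCountableTopology X] [BaireSpace Y] [T2Space Y]
    (T : X →L[ℝ] Y) (hT : Function.Surjective T) {U : Set X} (hU : U ∈ 𝓝 (0 : X)) :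
    T '' U ∈ 𝓝 (0 : Y) := by
  obtain ⟨u, hu, huu⟩ := IsTopologicalAddGroup.exists_antitone_basis_nhds_zero X
  have hmem : ∀ n, u n ∈ 𝓝 (0 : X) := fun n => hu.1.mem_of_mem trivial
  have h0 : ∀ n, (0 : X) ∈ u n := fun n => mem_of_mem_nhds (hmem n)
  obtain ⟨W, hW, hWc, hWU⟩ := exists_mem_nhds_isClosed_subset hU
  obtain ⟨N, -, hN⟩ := hu.1.mem_iff.1 hW
  have hc : ∀ n, closure (T '' u n) ∈ 𝓝 (0 : Y) := fun n =>
    closure_image_mem_nhds_zero T hT (hmem n)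
  refine mem_of_superset (hc (N + 1)) fun y hy => ?_
  -- Successive approximation: each remainder is corrected by an element of `u n`, leaving a
  -- remainder one level smaller. The corrections are then summed.
  have step : ∀ n, ∀ z ∈ closure (T '' u n), ∃ x ∈ u n, z - T x ∈ closure (T '' u (n + 1)) := by
    intro n z hz
    have hnb : (fun w => z - w) ⁻¹' closure (T '' u (n + 1)) ∈ 𝓝 z :=
      (continuous_const.sub continuous_id).continuousAt.preimage_mem_nhds (by simpa using hc (n + 1))
    obtain ⟨_, hw, x, hx, rfl⟩ := mem_closure_iff_nhds.1 hz _ hnb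
    exact ⟨x, hx, hw⟩
  choose! c hcu hcl using step
  let r : ℕ → Y := fun k => Nat.rec y (fun k z => z - T (c (N + 1 + k) z)) k
  have hr : ∀ k, r k ∈ closure (T '' u (N + 1 + k)) := by
    intro k
    induction k with
    | zero => exact hy
    | succ k ih => exact hcl _ _ ih
  let x : ℕ → X := fun k => c (N + 1 + k) (r k)
  have hx : ∀ k, x k ∈ u (N + 1 + k) := fun k => hcu _ _ (hr k)
  let s : ℕ → X := fun k => ∑ i ∈ Finset.range k, x i
  have hTs : ∀ k, T (s k) = y - r k := by
    intro k
    induction k with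
    | zero => simp [s, r]
    | succ k ih =>
      have h1 : s (k + 1) = s k + x k := Finset.sum_range_succ _ _
      have h2 : r (k + 1) = r k - T (x k) := rfl
      rw [h1, map_add, ih, h2]
      abel
  -- Since `u (n + 1) + u (n + 1) ⊆ u n`, a block of corrections starting at index `k` loses only
  -- one level, whatever its length.
  have hdiff : ∀ j k, s (k + j) - s k ∈ u (N + k) := by
    intro j
    induction j with
    | zero => intro k; simpa using h0 _
    | succ j ih =>
      intro k
      have h1 : s (k + 1) = s k + x k := Finset.sum_range_succ _ _
      have h2 : s (k + (j + 1)) - s k = x k + (s (k + 1 + j) - s (k + 1)) := by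
        rw [h1, show k + (j + 1) = k + 1 + j by omega]
        abel
      rw [h2]
      refine huu (N + k) (add_mem_add ?_ ?_)
      · simpa [add_right_comm] using hx k
      · simpa [add_assoc] using ih (k + 1)
  have hcs : CauchySeq s := by
    rw [cauchySeq_iff_tendsto, uniformity_eq_comap_nhds_zero X, tendsto_comap_iff]
    have key : ∀ V ∈ 𝓝 (0 : X), ∃ K, ∀ a ≥ K, ∀ b ≥ K, a ≤ b → s b - s a ∈ V := by
      intro V hV
      obtain ⟨M, -, hM⟩ := hu.1.mem_iff.1 hV
      refine ⟨M, fun a ha b _ hab => hM (hu.2 (show M ≤ N + a by omega) ?_)⟩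
      simpa [Nat.add_sub_cancel' hab] using hdiff (b - a) a
    refine fun V hV => ?_
    have hV' : -V ∈ 𝓝 (0 : X) := neg_mem_nhds_zero X hV
    obtain ⟨K, hK⟩ := key _ (inter_mem hV hV')
    refine mem_atTop_sets.2 ⟨(K, K), fun ab hab => ?_⟩
    rcases le_total ab.1 ab.2 with h | h
    · exact (hK _ hab.1 _ hab.2 h).1
    · simpa using (hK _ hab.2 _ hab.1 h).2
  obtain ⟨z, hz⟩ := cauchySeq_tendsto_of_complete hcs
  have hr0 : Tendsto r atTop (𝓝 0) := by
    refine fun V hV => ?_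
    obtain ⟨V', hV', hVc, hVV⟩ := exists_mem_nhds_isClosed_subset hV
    have hp : T ⁻¹' V' ∈ 𝓝 (0 : X) := T.continuous.continuousAt.preimage_mem_nhds (by simpa using hV')
    obtain ⟨M, -, hM⟩ := hu.1.mem_iff.1 hp
    refine mem_atTop_sets.2 ⟨M, fun k hk => hVV ?_⟩
    refine closure_minimal ?_ hVc (hr k)
    rintro _ ⟨a, ha, rfl⟩
    exact hM (hu.2 (show M ≤ N + 1 + k by omega) ha)
  refine ⟨z, hWU (hWc.mem_of_tendsto hz (Eventually.of_forall fun k => hN ?_)), ?_⟩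
  · simpa [s] using hdiff k 0
  · refine tendsto_nhds_unique ((T.continuous.tendsto z).comp hz) ?_
    have : Tendsto (fun k => y - r k) atTop (𝓝 (y - 0)) := tendsto_const_nhds.sub hr0
    rw [sub_zero] at this
    exact this.congr fun k => (hTs k).symm

end OpenMapping

/-! ### Lifting rapidly decreasing families -/

/-- The filter `ε → 0` on the index set. -/
def toZero : Filter Param := comap Subtype.val (𝓝 0)

theorem eventually_toZero_iff {P : Param → Prop} :
    (∀ᶠ ε in toZero, P ε) ↔ ∃ ε₀ : ℝ, 0 < ε₀ ∧ ∀ ε : Param, (ε : ℝ) < ε₀ → P ε := by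
  have hb := (Metric.nhds_basis_ball (x := (0 : ℝ))).comap (Subtype.val : Param → ℝ)
  rw [toZero, hb.eventually_iff]
  refine exists_congr fun a => and_congr_right fun _ => forall_congr' fun ε => ?_
  have := ε.2.1
  simp [abs_of_pos this]

section Decreasing

variable {X Y : Type*} [AddCommGroup X] [Module ℝ X] [AddCommGroup Y] [Module ℝ Y]

/-- `u_ε = O(ε^m)` for every `m` in a topological vector space. -/
def IsRapidlyDecreasing [TopologicalSpace X] (u : Param → X) : Prop :=
  ∀ m : ℕ, Tendsto (fun ε : Param => ((ε : ℝ)⁻¹) ^ m • u ε) toZero (𝓝 0)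

/-- Openness gives, for each fixed `k`, preimages of size `ε^k`, but these depend on `k`. A diagonal
choice `k = κ ε → ∞` makes a single preimage serve all orders. -/
theorem IsRapidlyDecreasing.exists_lift [TopologicalSpace X] [IsTopologicalAddGroup X]
    [ContinuousSMul ℝ X] [FirstCountableTopology X] [TopologicalSpace Y]
    (T : X →ₗ[ℝ] Y) (hT : Function.Surjective T)
    (hopen : ∀ U ∈ 𝓝 (0 : X), T '' U ∈ 𝓝 (0 : Y)) {v : Param → Y} (hv : IsRapidlyDecreasing v) :
    ∃ u : Param → X, (∀ ε, T (u ε) = v ε) ∧ IsRapidlyDecreasing u := by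
  classical
  obtain ⟨b, hb⟩ := (𝓝 (0 : X)).exists_antitone_basis
  have hbm : ∀ k, ∀ᶠ ε : Param in toZero, ((ε : ℝ)⁻¹) ^ k • v ε ∈ T '' b k := fun k =>
    (hv k).eventually (hopen _ (hb.1.mem_of_mem trivial))
  let good : Param → ℕ → Prop := fun ε k => ((ε : ℝ)⁻¹) ^ k • v ε ∈ T '' b k
  -- The cap only keeps the search finite; it tends to infinity as `ε → 0`. For `κ ε = 0` an
  -- arbitrary preimage is taken below, which is harmless because this does not occur for small `ε`.
  let κ : Param → ℕ := fun ε => Nat.findGreatest (fun k => good ε k) ⌈(ε : ℝ)⁻¹⌉₊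
  have hκ : ∀ K : ℕ, ∀ᶠ ε in toZero, K ≤ κ ε := by
    intro K
    have hK : ∀ᶠ ε : Param in toZero, (K : ℝ) ≤ (ε : ℝ)⁻¹ := by
      refine eventually_toZero_iff.2 ⟨((K : ℝ) + 1)⁻¹, by positivity, fun ε hε => ?_⟩
      have := (lt_inv_comm₀ ε.2.1 (by positivity)).1 hε
      linarith
    filter_upwards [hbm K, hK] with ε h1 h2
    exact Nat.le_findGreatest (by exact_mod_cast h2.trans (Nat.le_ceil _)) h1
  have hex : ∀ ε, ∃ x, T x = v ε ∧
      (κ ε ≠ 0 → ∃ w ∈ b (κ ε), x = ((ε : ℝ)) ^ (κ ε) • w) := by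
    intro ε
    by_cases h : κ ε = 0
    · obtain ⟨x, hx⟩ := hT (v ε)
      exact ⟨x, hx, fun h' => (h' h).elim⟩
    · obtain ⟨w, hw, hTw⟩ : good ε (κ ε) := Nat.findGreatest_of_ne_zero rfl h
      refine ⟨(ε : ℝ) ^ κ ε • w, ?_, fun _ => ⟨w, hw, rfl⟩⟩
      have : (ε : ℝ) ≠ 0 := ε.2.1.ne'
      rw [map_smul, hTw, smul_smul, ← mul_pow, mul_inv_cancel₀ this, one_pow, one_smul]
  choose u hu hu' using hex
  refine ⟨u, hu, fun m V hV => ?_⟩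
  -- A balanced neighbourhood absorbs the leftover factor `ε ^ (κ ε - m) ≤ 1`.
  obtain ⟨B, ⟨hB, hbal⟩, hBV⟩ := (nhds_basis_balanced ℝ X).mem_iff.1 hV
  obtain ⟨K, -, hK⟩ := hb.1.mem_iff.1 hB
  refine mem_map.2 ?_
  filter_upwards [hκ (max (max K m) 1)] with ε hε
  obtain ⟨w, hw, hx⟩ := hu' ε (by omega)
  have he : (ε : ℝ) ≠ 0 := ε.2.1.ne'
  have hs : ((ε : ℝ)⁻¹) ^ m • u ε = (ε : ℝ) ^ (κ ε - m) • w := by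
    rw [hx, smul_smul, ← pow_sub_mul_pow (ε : ℝ) (show m ≤ κ ε by omega), inv_pow]
    field_simp
  refine hBV ?_
  change ((ε : ℝ)⁻¹) ^ m • u ε ∈ B
  rw [hs]
  refine hbal.smul_mem ?_ (hK (hb.2 (show K ≤ κ ε by omega) hw))
  rw [Real.norm_of_nonneg (pow_nonneg ε.2.1.le _)]
  exact pow_le_one₀ ε.2.1.le ε.2.2

end Decreasing

/-- A closed linear relation between complete first countable spaces which is onto allows one to
lift rapidly decreasing families. -/
theorem IsRapidlyDecreasing.exists_lift_of_isClosed {X Y : Type*} [AddCommGroup X] [Module ℝ X]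
    [UniformSpace X] [IsUniformAddGroup X] [ContinuousSMul ℝ X] [CompleteSpace X]
    [FirstCountableTopology X] [AddCommGroup Y] [Module ℝ Y] [UniformSpace Y] [IsUniformAddGroup Y]
    [ContinuousSMul ℝ Y] [CompleteSpace Y] [FirstCountableTopology Y] [BaireSpace Y] [T2Space Y]
    {Γ : Submodule ℝ (X × Y)} (hΓ : IsClosed (Γ : Set (X × Y)))
    (hsurj : ∀ y, ∃ x, (x, y) ∈ Γ) {v : Param → Y} (hv : IsRapidlyDecreasing v) :
    ∃ u : Param → X, (∀ ε, (u ε, v ε) ∈ Γ) ∧ IsRapidlyDecreasing u := by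
  have : CompleteSpace Γ := hΓ.completeSpace_coe
  have : IsUniformAddGroup Γ := Γ.isUniformAddGroup
  have : FirstCountableTopology Γ := Topology.IsInducing.subtypeVal.firstCountableTopology
  -- The closed relation is itself complete and first countable, and its second projection is
  -- continuous and onto, so the open mapping theorem applies to it.
  let T : Γ →L[ℝ] Y := (ContinuousLinearMap.snd ℝ X Y).comp Γ.subtypeL
  have hT : Function.Surjective T := fun y =>
    let ⟨x, hx⟩ := hsurj y
    ⟨⟨(x, y), hx⟩, rfl⟩
  obtain ⟨γ, hγT, hγ⟩ := IsRapidlyDecreasing.exists_lift T.toLinearMap hT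
    (fun U hU => image_mem_nhds_zero T hT hU) hv
  refine ⟨fun ε => (γ ε).1.1, fun ε => ?_, fun m => ?_⟩
  · rw [← hγT ε]
    exact (γ ε).2
  · exact ((continuous_fst.comp continuous_subtype_val).tendsto (0 : Γ)).comp (hγ m)


/-! ### The Fréchet space of smooth functions -/

theorem baireSpace_of_complete (X : Type*) [UniformSpace X] [CompleteSpace X]
    [(uniformity X).IsCountablyGenerated] : BaireSpace X :=
  let _ := UniformSpace.pseudoMetricSpace X
  inferInstance

instance (X E : Type*) [TopologicalSpace X] [NormedAddCommGroup E] : IsUniformAddGroup C(X, E) := by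
  let f : C(X, E) →+ (UniformOnFun X E {K | IsCompact K}) :=
    { toFun := ContinuousMap.toUniformOnFunIsCompact
      map_zero' := rfl
      map_add' := fun _ _ => rfl }
  exact (ContinuousMap.isUniformEmbedding_toUniformOnFunIsCompact
    (α := X) (β := E)).isUniformInducing.isUniformAddGroup f

section SmoothJets

variable {p : ℕ} {F : Type*} [NormedAddCommGroup F] [NormedSpace ℝ F]

theorem _root_.ContDiffOn.contDiffAt_of_isOpen {E : Type*} [NormedAddCommGroup E] [NormedSpace ℝ E]
    {Ω : Set E} (hΩ : IsOpen Ω) {f : E → F} (hf : ContDiffOn ℝ ∞ f Ω) {x : E} (hx : x ∈ Ω) (k : ℕ) :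
    ContDiffAt ℝ k f x :=
  (hf.contDiffAt (hΩ.mem_nhds hx)).of_le (by exact_mod_cast le_top)

theorem _root_.ContDiffOn.iteratedFDeriv_of_isOpen {E : Type*} [NormedAddCommGroup E]
    [NormedSpace ℝ E] {Ω : Set E} (hΩ : IsOpen Ω) {f : E → F} (hf : ContDiffOn ℝ ∞ f Ω) (k : ℕ) :
    ContDiffOn ℝ ∞ (iteratedFDeriv ℝ k f) Ω := fun x hx =>
  ((hf.contDiffAt (hΩ.mem_nhds hx)).iteratedFDeriv_right
    (m := ∞) (i := k) (by norm_cast)).contDiffWithinAt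

variable (F)

/-- The Fréchet space of smooth `F`-valued functions on `Ω`, realized as the space of all sequences
of their iterated derivatives. -/
def smoothJets (Ω : TopologicalSpace.Opens (Space p)) :
    Submodule ℝ (∀ k : ℕ, C(Ω, Space p [×k]→L[ℝ] F)) where
  carrier := {g | ∃ f : Space p → F, ContDiffOn ℝ ∞ f Ω ∧
    ∀ k (x : Ω), g k x = iteratedFDeriv ℝ k f x}
  zero_mem' := ⟨0, contDiffOn_const, fun k x => by simp⟩
  add_mem' := by
    rintro g h ⟨f, hf, hgf⟩ ⟨e, he, hhe⟩
    refine ⟨f + e, hf.add he, fun k x => ?_⟩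
    rw [iteratedFDeriv_add_apply (hf.contDiffAt_of_isOpen Ω.isOpen x.2 k)
      (he.contDiffAt_of_isOpen Ω.isOpen x.2 k), ← hgf, ← hhe]
    rfl
  smul_mem' := by
    rintro c g ⟨f, hf, hgf⟩
    refine ⟨c • f, contDiffOn_const.smul hf, fun k x => ?_⟩
    rw [iteratedFDeriv_const_smul_apply (hf.contDiffAt_of_isOpen Ω.isOpen x.2 k), ← hgf]
    rfl

instance (Ω : TopologicalSpace.Opens (Space p)) : LocallyCompactSpace Ω :=
  Ω.isOpen.locallyCompactSpace

instance (Ω : TopologicalSpace.Opens (Space p)) : SigmaCompactSpace Ω :=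
  sigmaCompactSpace_of_locallyCompact_secondCountable

variable {F}

/-- Locally uniform convergence of all derivatives allows differentiation of the limit term by term,
so the limits form a Taylor series of the limit function. This is the completeness of `C^∞(Ω)`. -/
theorem isClosed_smoothJets [CompleteSpace F] (Ω : TopologicalSpace.Opens (Space p)) :
    IsClosed (smoothJets F Ω : Set (∀ k : ℕ, C(Ω, Space p [×k]→L[ℝ] F))) := by
  classical
  refine IsSeqClosed.isClosed fun g G hg hG => ?_
  choose f hf hgf using hg
  rw [tendsto_pi_nhds] at hG
  let Q : ∀ k : ℕ, Space p → Space p [×k]→L[ℝ] F := fun k x => if h : x ∈ Ω then G k ⟨x, h⟩ else 0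
  have hQ : ∀ k (x : Ω), Q k x = G k x := fun k x => dif_pos x.2
  have hunif : ∀ k, TendstoLocallyUniformlyOn (fun i => iteratedFDeriv ℝ k (f i))
      (Q k) atTop Ω := by
    intro k
    rw [tendstoLocallyUniformlyOn_iff_tendstoLocallyUniformly_comp_coe]
    have h := ContinuousMap.tendsto_iff_tendstoLocallyUniformly.1 (hG k)
    have e1 : (fun i (x : Ω) => iteratedFDeriv ℝ k (f i) x) = fun i x => g i k x := by
      funext i x
      exact (hgf i k x).symm
    have e2 : Q k ∘ Subtype.val = ⇑(G k) := funext fun x => hQ k x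
    rw [← e1, ← e2] at h
    exact h
  have hser : HasFTaylorSeriesUpToOn ∞ (fun x => (Q 0 x).curry0) (fun x k => Q k x) Ω := by
    refine ⟨fun _ _ => rfl, fun m _ x hx => ?_, fun m _ => ?_⟩
    · refine (hasFDerivAt_of_tendstoLocallyUniformlyOn (l := atTop) Ω.isOpen
        (f := fun i => iteratedFDeriv ℝ m (f i))
        (f' := fun i y => (iteratedFDeriv ℝ (m + 1) (f i) y).curryLeft)
        (g' := fun y => (Q (m + 1) y).curryLeft) ?_ ?_ ?_ hx).hasFDerivWithinAt
      · exact (continuousMultilinearCurryLeftEquiv ℝ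
          (fun _ : Fin (m + 1) => Space p) F).isometry.uniformContinuous.comp_tendstoLocallyUniformlyOn
            (hunif (m + 1))
      · intro i y hy
        have hd : DifferentiableAt ℝ (iteratedFDeriv ℝ m (f i)) y :=
          (((hf i).iteratedFDeriv_of_isOpen Ω.isOpen m).contDiffAt_of_isOpen Ω.isOpen hy
            1).differentiableAt (by norm_num)
        exact hd.hasFDerivAt
      · exact fun y hy => (hunif m).tendsto_at hy
    · change ContinuousOn (Q m) Ω
      rw [continuousOn_iff_continuous_domRestrict]
      have : (Ω : Set (Space p)).domRestrict (Q m) = G m := funext fun x => hQ m x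
      rw [this]
      exact (G m).continuous
  refine ⟨_, hser.contDiffOn, fun k x => ?_⟩
  rw [← hQ, ← iteratedFDerivWithin_of_isOpen k Ω.isOpen x.2]
  exact hser.eq_iteratedFDerivWithin_of_uniqueDiffOn (by exact_mod_cast le_top)
    Ω.isOpen.uniqueDiffOn x.2

instance [CompleteSpace F] (Ω : TopologicalSpace.Opens (Space p)) :
    CompleteSpace (smoothJets F Ω) :=
  (isClosed_smoothJets Ω).completeSpace_coe

instance (Ω : TopologicalSpace.Opens (Space p)) : IsUniformAddGroup (smoothJets F Ω) :=
  (smoothJets F Ω).isUniformAddGroup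

instance (Ω : TopologicalSpace.Opens (Space p)) :
    (uniformity (smoothJets F Ω)).IsCountablyGenerated :=
  inferInstanceAs (uniformity (smoothJets F Ω : Set (∀ k : ℕ,
    C(Ω, Space p [×k]→L[ℝ] F)))).IsCountablyGenerated

instance (Ω : TopologicalSpace.Opens (Space p)) : FirstCountableTopology (smoothJets F Ω) :=
  UniformSpace.firstCountableTopology (smoothJets F Ω)

instance [CompleteSpace F] (Ω : TopologicalSpace.Opens (Space p)) : BaireSpace (smoothJets F Ω) :=
  baireSpace_of_complete (smoothJets F Ω)

/-- The sequence of iterated derivatives of a smooth function on `Ω`. -/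
def toJets {Ω : TopologicalSpace.Opens (Space p)} (f : Space p → F) (hf : ContDiffOn ℝ ∞ f Ω) :
    smoothJets F Ω :=
  ⟨fun k => ⟨fun x => iteratedFDeriv ℝ k f x,
    continuousOn_iff_continuous_domRestrict.1 (hf.iteratedFDeriv_of_isOpen Ω.isOpen k).continuousOn⟩,
    f, hf, fun _ _ => rfl⟩

theorem isNegligible_iff_isRapidlyDecreasing {Ω : TopologicalSpace.Opens (Space p)}
    {u : Param → Space p → F} (hu : ∀ ε, ContDiffOn ℝ ∞ (u ε) Ω) :
    IsNegligible (Ω : Set (Space p)) u ↔ IsRapidlyDecreasing fun ε => toJets (u ε) (hu ε) := by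
  have key : ∀ m : ℕ, Tendsto (fun ε : Param => ((ε : ℝ)⁻¹) ^ m • toJets (u ε) (hu ε)) toZero (𝓝 0) ↔
      ∀ k, ∀ K : Set (Space p), IsCompact K → K ⊆ Ω → ∀ δ > 0, ∀ᶠ ε : Param in toZero, ∀ x ∈ K,
        ((ε : ℝ)⁻¹) ^ m * ‖iteratedFDeriv ℝ k (u ε) x‖ < δ := by
    intro m
    rw [tendsto_subtype_rng, tendsto_pi_nhds]
    refine forall_congr' fun k => ?_
    rw [ContinuousMap.tendsto_iff_forall_isCompact_tendstoUniformlyOn]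
    have hn : ∀ (ε : Param) (x : Ω), ‖((ε : ℝ)⁻¹) ^ m • iteratedFDeriv ℝ k (u ε) x‖ =
        ((ε : ℝ)⁻¹) ^ m * ‖iteratedFDeriv ℝ k (u ε) x‖ := by
      intro ε x
      rw [norm_smul, Real.norm_of_nonneg (pow_nonneg (inv_nonneg.2 ε.2.1.le) _)]
    constructor
    · intro h K hK hKΩ δ hδ
      have hK' : IsCompact (Subtype.val ⁻¹' K : Set Ω) :=
        Topology.IsInducing.subtypeVal.isCompact_preimage_iff (by simpa using hKΩ) |>.2 hK
      filter_upwards [Metric.tendstoUniformlyOn_iff.1 (h _ hK') δ hδ] with ε hε x hx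
      have := hε ⟨x, hKΩ hx⟩ hx
      rw [dist_comm, dist_eq_norm] at this
      rw [← hn ε ⟨x, hKΩ hx⟩]
      exact (congrArg norm (sub_zero _)).symm.trans_lt this
    · intro h K hK
      rw [Metric.tendstoUniformlyOn_iff]
      intro δ hδ
      filter_upwards [h _ (hK.image continuous_subtype_val) (by rintro _ ⟨x, -, rfl⟩; exact x.2) δ hδ]
        with ε hε x hx
      have := hε x (mem_image_of_mem _ hx)
      rw [dist_comm, dist_eq_norm]
      rw [← hn] at this
      exact (congrArg norm (sub_zero _)).trans_lt this
  constructor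
  · intro h m
    refine (key m).2 fun k K hK hKΩ δ hδ => ?_
    -- The extra power of `ε` beats the constant and turns boundedness into convergence to zero.
    obtain ⟨C, ε₀, h0, hC⟩ := h.2 K hK hKΩ k (m + 1)
    refine eventually_toZero_iff.2 ⟨min ε₀ (δ / (|C| + 1)), lt_min h0 (by positivity),
      fun ε hε x hx => ?_⟩
    have hpos := ε.2.1
    have h1 := hC ε (hε.trans_le (min_le_left _ _)) x hx
    have h2 := (lt_div_iff₀ (by positivity)).1 (hε.trans_le (min_le_right _ _))
    calc ((ε : ℝ)⁻¹) ^ m * ‖iteratedFDeriv ℝ k (u ε) x‖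
        ≤ ((ε : ℝ)⁻¹) ^ m * (C * (ε : ℝ) ^ (m + 1)) := by gcongr
      _ = C * ε := by
          have : (ε : ℝ) ≠ 0 := hpos.ne'
          rw [inv_pow]
          field_simp
          ring
      _ ≤ ε * (|C| + 1) := by nlinarith [le_abs_self C]
      _ < δ := h2
  · intro h
    refine ⟨hu, fun K hK hKΩ k m => ?_⟩
    obtain ⟨ε₀, h0, hε⟩ := eventually_toZero_iff.1 ((key m).1 (h m) k K hK hKΩ 1 one_pos)
    refine ⟨1, ε₀, h0, fun ε he x hx => ?_⟩
    have hpos : 0 < (ε : ℝ) ^ m := pow_pos ε.2.1 _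
    have := hε ε he x hx
    rw [inv_pow, inv_mul_lt_iff₀ hpos] at this
    linarith

end SmoothJets


/-! ### Interpolation of derivatives -/

section Calculus

variable {E F : Type*} [NormedAddCommGroup E] [NormedSpace ℝ E] [NormedAddCommGroup F]
  [NormedSpace ℝ F]

theorem norm_iteratedFDeriv_iteratedFDeriv (f : E → F) (j k : ℕ) (x : E) :
    ‖iteratedFDeriv ℝ k (iteratedFDeriv ℝ j f) x‖ = ‖iteratedFDeriv ℝ (k + j) f x‖ := by
  induction j generalizing k with
  | zero =>
    rw [iteratedFDeriv_zero_eq_comp, LinearIsometryEquiv.norm_iteratedFDeriv_comp_left]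
    rfl
  | succ j ih =>
    have h := LinearIsometryEquiv.norm_iteratedFDeriv_comp_left (𝕜 := ℝ)
      (F := E →L[ℝ] E [×j]→L[ℝ] F) (G := E [×(j + 1)]→L[ℝ] F)
      (continuousMultilinearCurryLeftEquiv ℝ (fun _ : Fin (j + 1) => E) F).symm
        (fderiv ℝ (iteratedFDeriv ℝ j f)) x k
    rw [iteratedFDeriv_succ_eq_comp_left]
    refine h.trans ?_
    rw [norm_iteratedFDeriv_fderiv, ih, add_right_comm, add_assoc]

/-- Interpolation: the first derivative is controlled by the function and its second derivative. -/
theorem norm_fderiv_le_of_norm_le {g : E → F} {x : E} {h A B : ℝ} (hh : 0 < h)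
    (hg : ∀ y ∈ Metric.closedBall x h, ContDiffAt ℝ 2 g y)
    (hA : ∀ y ∈ Metric.closedBall x h, ‖g y‖ ≤ A)
    (hB : ∀ y ∈ Metric.closedBall x h, ‖iteratedFDeriv ℝ 2 g y‖ ≤ B) :
    ‖fderiv ℝ g x‖ ≤ 2 * A / h + B * h := by
  have hx : x ∈ Metric.closedBall x h := Metric.mem_closedBall_self hh.le
  have hA0 : 0 ≤ A := (norm_nonneg _).trans (hA x hx)
  have hB0 : 0 ≤ B := (norm_nonneg _).trans (hB x hx)
  have hconv := convex_closedBall x h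
  -- As the derivative varies by at most `B * h` on the ball, an increment of `g` over a step of
  -- length `h` differs from its linear part by at most `B * h * h`; the increment itself is at most
  -- `2 * A`.
  have h1 : ∀ y ∈ Metric.closedBall x h, ‖fderiv ℝ g y - fderiv ℝ g x‖ ≤ B * h := by
    intro y hy
    refine (hconv.norm_image_sub_le_of_norm_fderiv_le (𝕜 := ℝ) (f := fderiv ℝ g) (C := B) ?_ ?_
      hx hy).trans ?_
    · intro z hz
      exact ((hg z hz).fderiv_right (m := 1) (by norm_num)).differentiableAt (by norm_num)
    · intro z hz
      rw [← norm_iteratedFDeriv_one, norm_iteratedFDeriv_fderiv]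
      exact hB z hz
    · gcongr
      rwa [← dist_eq_norm]
  refine ContinuousLinearMap.opNorm_le_of_unit_norm (by positivity) fun v hv => ?_
  have hy : x + h • v ∈ Metric.closedBall x h := by
    rw [Metric.mem_closedBall, dist_eq_norm, add_sub_cancel_left, norm_smul, hv, mul_one,
      Real.norm_of_nonneg hh.le]
  have h2 := hconv.norm_image_sub_le_of_norm_hasFDerivWithin_le' (𝕜 := ℝ) (f := g)
    (fun z hz => ((hg z hz).differentiableAt (by norm_num)).hasFDerivAt.hasFDerivWithinAt)
    h1 hx hy
  rw [add_sub_cancel_left, norm_smul, hv, mul_one, Real.norm_of_nonneg hh.le, map_smul] at h2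
  have h3 : ‖h • fderiv ℝ g x v‖ ≤ A + A + B * h * h := by
    have e : h • fderiv ℝ g x v =
        g (x + h • v) - g x - (g (x + h • v) - g x - h • fderiv ℝ g x v) := by abel
    rw [e]
    exact (norm_sub_le _ _).trans
      (add_le_add ((norm_sub_le _ _).trans (add_le_add (hA _ hy) (hA _ hx))) h2)
  rw [norm_smul, Real.norm_of_nonneg hh.le] at h3
  rw [← mul_le_mul_iff_right₀ hh]
  refine h3.trans (le_of_eq ?_)
  field_simp
  ring

end Calculus

/-! ### Growth orders in `ε` -/

section Growth

variable {E : Type*} {K : Set E} {a b : Param → E → ℝ}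

/-- `a_ε = O(ε^{-N})` uniformly on `K` for some `N`. -/
def ModerateOn (K : Set E) (a : Param → E → ℝ) : Prop :=
  ∃ N : ℕ, ∀ᶠ ε : Param in toZero, ∀ x ∈ K, a ε x ≤ ((ε : ℝ)⁻¹) ^ N

/-- `a_ε = O(ε^m)` uniformly on `K` for all `m`. -/
def NegligibleOn (K : Set E) (a : Param → E → ℝ) : Prop :=
  ∀ m : ℕ, ∀ᶠ ε : Param in toZero, ∀ x ∈ K, a ε x ≤ (ε : ℝ) ^ m

theorem one_le_inv_param (ε : Param) : 1 ≤ (ε : ℝ)⁻¹ := (one_le_inv₀ ε.2.1).2 ε.2.2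

theorem eventually_mul_le_one (C : ℝ) : ∀ᶠ ε : Param in toZero, C * (ε : ℝ) ≤ 1 := by
  refine eventually_toZero_iff.2 ⟨(|C| + 1)⁻¹, by positivity, fun ε hε => ?_⟩
  have h1 := (lt_inv_comm₀ ε.2.1 (by positivity)).1 hε
  have h2 : |C| * ε ≤ 1 := by
    have := mul_lt_mul_of_pos_right h1 ε.2.1
    rw [inv_mul_cancel₀ ε.2.1.ne'] at this
    nlinarith [ε.2.1]
  nlinarith [ε.2.1, le_abs_self C]

theorem eventually_le_inv (C : ℝ) : ∀ᶠ ε : Param in toZero, C ≤ (ε : ℝ)⁻¹ := by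
  filter_upwards [eventually_mul_le_one C] with ε hε
  rwa [← one_div, le_div_iff₀ ε.2.1]

/-- One more power of `ε⁻¹` swallows any constant, so constants can be dropped from the bookkeeping.
-/
theorem moderateOn_iff : ModerateOn K a ↔ ∃ N : ℕ, ∃ C : ℝ, ∃ ε₀ : ℝ, 0 < ε₀ ∧
    ∀ ε : Param, (ε : ℝ) < ε₀ → ∀ x ∈ K, a ε x ≤ C * ((ε : ℝ)⁻¹) ^ N := by
  constructor
  · rintro ⟨N, h⟩
    obtain ⟨ε₀, h0, h⟩ := eventually_toZero_iff.1 h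
    exact ⟨N, 1, ε₀, h0, by simpa using h⟩
  · rintro ⟨N, C, h⟩
    refine ⟨N + 1, ?_⟩
    filter_upwards [eventually_toZero_iff.2 h, eventually_le_inv C] with ε h1 h2 x hx
    have := one_le_inv_param ε
    refine (h1 x hx).trans ?_
    rw [pow_succ']
    gcongr

theorem negligibleOn_iff : NegligibleOn K a ↔ ∀ m : ℕ, ∃ C : ℝ, ∃ ε₀ : ℝ, 0 < ε₀ ∧
    ∀ ε : Param, (ε : ℝ) < ε₀ → ∀ x ∈ K, a ε x ≤ C * (ε : ℝ) ^ m := by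
  constructor
  · intro h m
    obtain ⟨ε₀, h0, h⟩ := eventually_toZero_iff.1 (h m)
    exact ⟨1, ε₀, h0, by simpa using h⟩
  · intro h m
    obtain ⟨C, h⟩ := h (m + 1)
    filter_upwards [eventually_toZero_iff.2 h, eventually_mul_le_one C] with ε h1 h2 x hx
    have hpos := ε.2.1
    calc a ε x ≤ C * (ε : ℝ) ^ (m + 1) := h1 x hx
      _ = (C * ε) * (ε : ℝ) ^ m := by ring
      _ ≤ 1 * (ε : ℝ) ^ m := by gcongr
      _ = (ε : ℝ) ^ m := one_mul _

theorem ModerateOn.mono (ha : ModerateOn K a) (h : ∀ ε, ∀ x ∈ K, b ε x ≤ a ε x) :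
    ModerateOn K b :=
  ha.imp fun _ hN => hN.mono fun ε hε x hx => (h ε x hx).trans (hε x hx)

theorem moderateOn_const (C : ℝ) : ModerateOn K fun _ _ => C :=
  ⟨1, by simpa using (eventually_le_inv C).mono fun ε hε _ _ => hε⟩

theorem ModerateOn.mul (ha : ModerateOn K a) (hb : ModerateOn K b)
    (hb0 : ∀ ε, ∀ x ∈ K, 0 ≤ b ε x) : ModerateOn K fun ε x => a ε x * b ε x := by
  obtain ⟨N, hN⟩ := ha
  obtain ⟨M, hM⟩ := hb
  refine ⟨N + M, ?_⟩
  filter_upwards [hN, hM] with ε h1 h2 x hx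
  have := one_le_inv_param ε
  rw [pow_add]
  exact mul_le_mul (h1 x hx) (h2 x hx) (hb0 ε x hx) (by positivity)

theorem ModerateOn.add (ha : ModerateOn K a) (hb : ModerateOn K b) :
    ModerateOn K fun ε x => a ε x + b ε x := by
  obtain ⟨N, hN⟩ := ha
  obtain ⟨M, hM⟩ := hb
  refine moderateOn_iff.2 ⟨max N M, 2, eventually_toZero_iff.1 ?_⟩
  filter_upwards [hN, hM] with ε h1 h2 x hx
  have h0 := one_le_inv_param ε
  have h3 := pow_le_pow_right₀ h0 (le_max_left N M)
  have h4 := pow_le_pow_right₀ h0 (le_max_right N M)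
  linarith [h1 x hx, h2 x hx]

theorem ModerateOn.pow (ha : ModerateOn K a) (ha0 : ∀ ε, ∀ x ∈ K, 0 ≤ a ε x) (n : ℕ) :
    ModerateOn K fun ε x => a ε x ^ n := by
  induction n with
  | zero => simpa using moderateOn_const (K := K) 1
  | succ n ih => simpa only [pow_succ] using ih.mul ha ha0

theorem ModerateOn.sum {ι : Type*} (s : Finset ι) {c : ι → Param → E → ℝ}
    (h : ∀ i ∈ s, ModerateOn K (c i)) : ModerateOn K fun ε x => ∑ i ∈ s, c i ε x := by
  classical
  induction s using Finset.induction_on with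
  | empty => simpa using moderateOn_const (K := K) 0
  | insert i s hi ih =>
    simp only [Finset.sum_insert hi]
    exact (h i (Finset.mem_insert_self _ _)).add (ih fun j hj => h j (Finset.mem_insert_of_mem hj))

theorem NegligibleOn.mono (ha : NegligibleOn K a) (h : ∀ ε, ∀ x ∈ K, b ε x ≤ a ε x) :
    NegligibleOn K b :=
  fun m => (ha m).mono fun ε hε x hx => (h ε x hx).trans (hε x hx)

theorem ModerateOn.mul_negligibleOn (ha : ModerateOn K a) (hb : NegligibleOn K b)
    (hb0 : ∀ ε, ∀ x ∈ K, 0 ≤ b ε x) : NegligibleOn K fun ε x => a ε x * b ε x := by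
  obtain ⟨N, hN⟩ := ha
  intro m
  filter_upwards [hN, hb (N + m)] with ε h1 h2 x hx
  have hpos := ε.2.1
  calc a ε x * b ε x ≤ ((ε : ℝ)⁻¹) ^ N * (ε : ℝ) ^ (N + m) :=
        mul_le_mul (h1 x hx) (h2 x hx) (hb0 ε x hx) (by positivity)
    _ = (ε : ℝ) ^ m := by
      rw [pow_add, ← mul_assoc, ← mul_pow, inv_mul_cancel₀ hpos.ne', one_pow, one_mul]

end Growth

/-! ### Moderate and negligible families under composition -/

section Families

variable {p : ℕ} {F F' : Type*} [NormedAddCommGroup F] [NormedSpace ℝ F] [NormedAddCommGroup F']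
  [NormedSpace ℝ F'] {Ω : Set (Space p)} {u v : Param → Space p → F}

theorem isModerate_iff : IsModerate Ω u ↔ (∀ ε, ContDiffOn ℝ ∞ (u ε) Ω) ∧
    ∀ K, IsCompact K → K ⊆ Ω → ∀ k : ℕ, ModerateOn K fun ε x => ‖iteratedFDeriv ℝ k (u ε) x‖ := by
  simp only [moderateOn_iff, IsModerate]

theorem isNegligible_iff : IsNegligible Ω u ↔ (∀ ε, ContDiffOn ℝ ∞ (u ε) Ω) ∧
    ∀ K, IsCompact K → K ⊆ Ω → ∀ k : ℕ,
      NegligibleOn K fun ε x => ‖iteratedFDeriv ℝ k (u ε) x‖ := by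
  simp only [negligibleOn_iff, IsNegligible]

theorem IsModerate.moderateOn_norm (h : IsModerate Ω u) {K : Set (Space p)} (hK : IsCompact K)
    (hKΩ : K ⊆ Ω) : ModerateOn K fun ε x => ‖u ε x‖ := by
  simpa using (isModerate_iff.1 h).2 K hK hKΩ 0

theorem IsNegligible.negligibleOn_norm (h : IsNegligible Ω u) {K : Set (Space p)}
    (hK : IsCompact K) (hKΩ : K ⊆ Ω) : NegligibleOn K fun ε x => ‖u ε x‖ := by
  simpa using (isNegligible_iff.1 h).2 K hK hKΩ 0

theorem IsNegligible.isModerate (h : IsNegligible Ω u) : IsModerate Ω u := by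
  refine isModerate_iff.2 ⟨h.1, fun K hK hKΩ k => ⟨0, ?_⟩⟩
  simpa using (isNegligible_iff.1 h).2 K hK hKΩ k 0

theorem isModerate_const (hΩ : IsOpen Ω) {f : Space p → F} (hf : ContDiffOn ℝ ∞ f Ω) :
    IsModerate Ω fun _ => f := by
  refine isModerate_iff.2 ⟨fun _ => hf, fun K hK hKΩ k => ?_⟩
  obtain ⟨C, hC⟩ := hK.exists_bound_of_continuousOn
    ((hf.iteratedFDeriv_of_isOpen hΩ k).continuousOn.mono hKΩ)
  exact (moderateOn_const C).mono fun _ x hx => hC x hx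

/-- A moderate family is negligible as soon as it satisfies the negligibility estimates of
order zero. -/
theorem IsModerate.isNegligible (hΩ : IsOpen Ω) (h : IsModerate Ω u)
    (h0 : ∀ K, IsCompact K → K ⊆ Ω → NegligibleOn K fun ε x => ‖u ε x‖) : IsNegligible Ω u := by
  rw [isModerate_iff] at h
  have key : ∀ k : ℕ, ∀ K, IsCompact K → K ⊆ Ω →
      NegligibleOn K fun ε x => ‖iteratedFDeriv ℝ k (u ε) x‖ := by
    intro k
    induction k with
    | zero => simpa using h0
    | succ k ih =>
      intro K hK hKΩ m
      -- Interpolation on balls around points of `K` needs the estimates on a slightly larger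
      -- compact set.
      obtain ⟨δ, hδ, hδΩ⟩ := hK.exists_cthickening_subset_open hΩ hKΩ
      have hK' : IsCompact (Metric.cthickening δ K) := hK.cthickening
      obtain ⟨N, hN⟩ := h.2 _ hK' hδΩ (2 + k)
      -- With step length `ε^s`, value bound `ε^(s+m+1)` and second-derivative bound `ε^(-N)`, both
      -- interpolation terms are multiples of `ε^(m+1)`, with sum `3 * ε^(m+1)`; the spare `ε`
      -- absorbs the 3.
      set s := N + m + 1 with hs
      filter_upwards [hN, ih _ hK' hδΩ (s + m + 1), eventually_mul_le_one δ⁻¹,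
        eventually_mul_le_one 3] with ε h1 h2 h3 h4 x hx
      have hpos : 0 < (ε : ℝ) := ε.2.1
      have hle : (ε : ℝ) ^ s ≤ δ := by
        calc (ε : ℝ) ^ s ≤ (ε : ℝ) ^ 1 := pow_le_pow_of_le_one hpos.le ε.2.2 (by omega)
          _ ≤ δ := by rwa [inv_mul_le_iff₀ hδ, mul_one, ← pow_one (ε : ℝ)] at h3
      have hball : Metric.closedBall x ((ε : ℝ) ^ s) ⊆ Metric.cthickening δ K :=
        (Metric.closedBall_subset_closedBall hle).trans (Metric.closedBall_subset_cthickening hx δ)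
      have h5 := norm_fderiv_le_of_norm_le (g := iteratedFDeriv ℝ k (u ε)) (x := x)
        (pow_pos hpos s)
        (fun y hy => ((h.1 ε).iteratedFDeriv_of_isOpen hΩ k).contDiffAt_of_isOpen hΩ
          (hδΩ (hball hy)) 2)
        (fun y hy => h2 y (hball hy))
        (fun y hy => by
          rw [norm_iteratedFDeriv_iteratedFDeriv]
          exact h1 y (hball hy))
      rw [norm_fderiv_iteratedFDeriv] at h5
      calc ‖iteratedFDeriv ℝ (k + 1) (u ε) x‖
          ≤ 2 * (ε : ℝ) ^ (s + m + 1) / (ε : ℝ) ^ s + ((ε : ℝ)⁻¹) ^ N * (ε : ℝ) ^ s := h5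
        _ = (3 * ε) * (ε : ℝ) ^ m := by
          rw [hs, inv_pow]
          field_simp
          ring
        _ ≤ 1 * (ε : ℝ) ^ m := by gcongr
        _ = (ε : ℝ) ^ m := one_mul _
  exact isNegligible_iff.2 ⟨h.1, fun K hK hKΩ k => key k K hK hKΩ⟩

theorem IsModerate.of_norm_le {w : Param → Space p → F'} (h : IsModerate Ω u)
    (hw : ∀ ε, ContDiffOn ℝ ∞ (w ε) Ω)
    (hle : ∀ k, ∃ c : ℝ, ∃ j : ℕ, 0 ≤ c ∧ ∀ ε, ∀ x ∈ Ω,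
      ‖iteratedFDeriv ℝ k (w ε) x‖ ≤ c * ‖iteratedFDeriv ℝ j (u ε) x‖) : IsModerate Ω w := by
  rw [isModerate_iff] at h ⊢
  refine ⟨hw, fun K hK hKΩ k => ?_⟩
  obtain ⟨c, j, -, hc⟩ := hle k
  exact ((moderateOn_const c).mul (h.2 K hK hKΩ j) fun _ _ _ => norm_nonneg _).mono
    fun ε x hx => hc ε x (hKΩ hx)

theorem IsNegligible.of_norm_le {w : Param → Space p → F'} (h : IsNegligible Ω u)
    (hw : ∀ ε, ContDiffOn ℝ ∞ (w ε) Ω)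
    (hle : ∀ k, ∃ c : ℝ, ∃ j : ℕ, 0 ≤ c ∧ ∀ ε, ∀ x ∈ Ω,
      ‖iteratedFDeriv ℝ k (w ε) x‖ ≤ c * ‖iteratedFDeriv ℝ j (u ε) x‖) : IsNegligible Ω w := by
  rw [isNegligible_iff] at h ⊢
  refine ⟨hw, fun K hK hKΩ k => ?_⟩
  obtain ⟨c, j, -, hc⟩ := hle k
  exact ((moderateOn_const c).mul_negligibleOn (h.2 K hK hKΩ j) fun _ _ _ => norm_nonneg _).mono
    fun ε x hx => hc ε x (hKΩ hx)

variable {Z : Type*} [NormedAddCommGroup Z] [NormedSpace ℝ Z]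

/-- A crude form of the Faà di Bruno estimate. The summand 1 makes the base at least 1, so it also
bounds the `i`-th derivative of `f` by its own `i`-th power for `i ≥ 1`. -/
theorem norm_iteratedFDeriv_comp_le_sum (hΩ : IsOpen Ω) {T : Set Z} (hT : IsOpen T) {g : Z → F}
    {f : Space p → Z} (hg : ContDiffOn ℝ ∞ g T) (hf : ContDiffOn ℝ ∞ f Ω) (hfT : MapsTo f Ω T)
    {x : Space p} (hx : x ∈ Ω) (k : ℕ) :
    ‖iteratedFDeriv ℝ k (g ∘ f) x‖ ≤ k.factorial *
      (∑ i ∈ Finset.range (k + 1), ‖iteratedFDeriv ℝ i g (f x)‖) *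
      (1 + ∑ i ∈ Finset.range (k + 1), ‖iteratedFDeriv ℝ i f x‖) ^ k := by
  have hS : ∀ i ≤ k, ∀ c : ℕ → ℝ, (∀ i, 0 ≤ c i) → c i ≤ ∑ i ∈ Finset.range (k + 1), c i :=
    fun i hi c hc => Finset.single_le_sum (fun j _ => hc j) (Finset.mem_range.2 (by omega))
  have hn : 0 ≤ ∑ i ∈ Finset.range (k + 1), ‖iteratedFDeriv ℝ i f x‖ :=
    Finset.sum_nonneg fun _ _ => norm_nonneg _
  rw [← iteratedFDerivWithin_of_isOpen k hΩ hx]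
  refine norm_iteratedFDerivWithin_comp_le hg hf (by exact_mod_cast le_top) hT.uniqueDiffOn
    hΩ.uniqueDiffOn hfT hx (fun i hi => ?_) (fun i hi1 hi => ?_)
  · rw [iteratedFDerivWithin_of_isOpen i hT (hfT hx)]
    exact hS i hi (fun i => ‖iteratedFDeriv ℝ i g (f x)‖) fun _ => norm_nonneg _
  · rw [iteratedFDerivWithin_of_isOpen i hΩ hx]
    have h1 := hS i hi (fun i => ‖iteratedFDeriv ℝ i f x‖) fun _ => norm_nonneg _
    refine le_trans ?_ (le_self_pow₀ (by linarith) (by omega))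
    linarith

/-- Composition of moderate families. -/
theorem IsModerate.comp (hΩ : IsOpen Ω) {T : Set Z} (hT : IsOpen T) {g : Param → Z → F}
    {f : Param → Space p → Z} (hf : IsModerate Ω f) (hfT : ∀ ε, MapsTo (f ε) Ω T)
    (hg : ∀ ε, ContDiffOn ℝ ∞ (g ε) T)
    (hgf : ∀ K, IsCompact K → K ⊆ Ω → ∀ k : ℕ,
      ModerateOn K fun ε x => ‖iteratedFDeriv ℝ k (g ε) (f ε x)‖) :
    IsModerate Ω fun ε => g ε ∘ f ε := by
  rw [isModerate_iff] at hf ⊢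
  refine ⟨fun ε => (hg ε).comp (hf.1 ε) (hfT ε), fun K hK hKΩ k => ?_⟩
  have h1 : ModerateOn K fun ε x =>
      ∑ i ∈ Finset.range (k + 1), ‖iteratedFDeriv ℝ i (g ε) (f ε x)‖ :=
    ModerateOn.sum _ fun i _ => hgf K hK hKΩ i
  have h2 : ModerateOn K fun ε x =>
      1 + ∑ i ∈ Finset.range (k + 1), ‖iteratedFDeriv ℝ i (f ε) x‖ :=
    (moderateOn_const 1).add (ModerateOn.sum _ fun i _ => hf.2 K hK hKΩ i)
  have h20 : ∀ ε, ∀ x ∈ K, 0 ≤ 1 + ∑ i ∈ Finset.range (k + 1), ‖iteratedFDeriv ℝ i (f ε) x‖ :=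
    fun _ _ _ => by positivity
  exact (((moderateOn_const (k.factorial : ℝ)).mul h1 fun _ _ _ => by positivity).mul (h2.pow h20 k)
    fun ε x hx => pow_nonneg (h20 ε x hx) k).mono fun ε x hx =>
      norm_iteratedFDeriv_comp_le_sum hΩ hT (hg ε) (hf.1 ε) (hfT ε) (hKΩ hx) k

theorem IsModerate.comp_smooth {p' : ℕ} {Ω' : Set (Space p')} (hΩ : IsOpen Ω) (hΩ' : IsOpen Ω')
    (hu : IsModerate Ω u) {ψ : Space p' → Space p} (hψ : ContDiffOn ℝ ∞ ψ Ω')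
    (hmaps : MapsTo ψ Ω' Ω) : IsModerate Ω' fun ε => u ε ∘ ψ := by
  refine (isModerate_const hΩ' hψ).comp hΩ' hΩ (fun _ => hmaps) hu.1 fun K hK hKΩ k => ?_
  obtain ⟨N, hN⟩ := (isModerate_iff.1 hu).2 _ (hK.image_of_continuousOn (hψ.continuousOn.mono hKΩ))
    ((hmaps.mono_left hKΩ).image_subset) k
  exact ⟨N, hN.mono fun ε hε x hx => hε _ (mem_image_of_mem _ hx)⟩

theorem IsNegligible.comp_smooth {p' : ℕ} {Ω' : Set (Space p')} (hΩ : IsOpen Ω) (hΩ' : IsOpen Ω')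
    (hu : IsNegligible Ω u) {ψ : Space p' → Space p} (hψ : ContDiffOn ℝ ∞ ψ Ω')
    (hmaps : MapsTo ψ Ω' Ω) : IsNegligible Ω' fun ε => u ε ∘ ψ := by
  refine (hu.isModerate.comp_smooth hΩ hΩ' hψ hmaps).isNegligible hΩ' fun K hK hKΩ m => ?_
  exact (hu.negligibleOn_norm (hK.image_of_continuousOn (hψ.continuousOn.mono hKΩ))
    ((hmaps.mono_left hKΩ).image_subset) m).mono fun ε hε x hx => hε _ (mem_image_of_mem _ hx)

theorem IsModerate.clm_comp (L : F →L[ℝ] F') (hΩ : IsOpen Ω) (hu : IsModerate Ω u) :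
    IsModerate Ω fun ε => L ∘ u ε :=
  hu.of_norm_le (fun ε => L.contDiff.comp_contDiffOn (hu.1 ε)) fun k =>
    ⟨‖L‖, k, norm_nonneg _, fun ε _ hx =>
      L.norm_iteratedFDeriv_comp_left ((hu.1 ε).contDiffAt_of_isOpen hΩ hx k) le_rfl⟩

theorem IsNegligible.clm_comp (L : F →L[ℝ] F') (hΩ : IsOpen Ω) (hu : IsNegligible Ω u) :
    IsNegligible Ω fun ε => L ∘ u ε :=
  hu.of_norm_le (fun ε => L.contDiff.comp_contDiffOn (hu.1 ε)) fun k =>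
    ⟨‖L‖, k, norm_nonneg _, fun ε _ hx =>
      L.norm_iteratedFDeriv_comp_left ((hu.1 ε).contDiffAt_of_isOpen hΩ hx k) le_rfl⟩

theorem IsModerate.iteratedFDeriv (hΩ : IsOpen Ω) (hu : IsModerate Ω u) (j : ℕ) :
    IsModerate Ω fun ε => iteratedFDeriv ℝ j (u ε) :=
  hu.of_norm_le (fun ε => (hu.1 ε).iteratedFDeriv_of_isOpen hΩ j) fun k =>
    ⟨1, k + j, zero_le_one, fun ε x _ => by rw [norm_iteratedFDeriv_iteratedFDeriv, one_mul]⟩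

theorem IsNegligible.iteratedFDeriv (hΩ : IsOpen Ω) (hu : IsNegligible Ω u) (j : ℕ) :
    IsNegligible Ω fun ε => iteratedFDeriv ℝ j (u ε) :=
  hu.of_norm_le (fun ε => (hu.1 ε).iteratedFDeriv_of_isOpen hΩ j) fun k =>
    ⟨1, k + j, zero_le_one, fun ε x _ => by rw [norm_iteratedFDeriv_iteratedFDeriv, one_mul]⟩

/-- `u ↦ Φ(x, u)` is slowly increasing, uniformly for `x` in compact subsets of `Ω`. -/
structure SlowlyIncreasingOn (Ω : Set (Space p)) (Φ : Space p × F → F') : Prop where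
  contDiffOn : ContDiffOn ℝ ∞ Φ (Ω ×ˢ univ)
  bound : ∀ K, IsCompact K → K ⊆ Ω → ∀ k : ℕ, ∃ N : ℕ, ∃ C : ℝ, ∀ x ∈ K, ∀ y : F,
    ‖iteratedFDeriv ℝ k Φ (x, y)‖ ≤ C * (1 + ‖y‖) ^ N

/-- The family is `Φ` composed with the graph maps of `u_ε`; polynomial growth of the derivatives of
`Φ` in the fibre variable keeps them moderate along moderate values. -/
theorem SlowlyIncreasingOn.isModerate_comp (Ω : TopologicalSpace.Opens (Space p))
    {Φ : Space p × F → F'} (hΦ : SlowlyIncreasingOn Ω Φ) {u : Param → Space p → F}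
    (hu : IsModerate Ω u) : IsModerate Ω fun ε x => Φ (x, u ε x) := by
  have h1 := (isModerate_const Ω.isOpen (f := fun x : Space p => x) contDiffOn_id).clm_comp
    (ContinuousLinearMap.inl ℝ (Space p) F) Ω.isOpen
  have h2 := hu.clm_comp (ContinuousLinearMap.inr ℝ (Space p) F) Ω.isOpen
  have h3 : IsModerate (Ω : Set (Space p)) fun ε x => (x, u ε x) := by
    have e : (fun (ε : Param) (x : Space p) => (x, u ε x)) =
        (fun _ => ContinuousLinearMap.inl ℝ (Space p) F ∘ fun x => x) +
          fun ε => ContinuousLinearMap.inr ℝ (Space p) F ∘ u ε := by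
      funext ε x
      simp
    rw [e]
    exact (moderate (Space p × F) Ω).add_mem h1 h2
  refine h3.comp (g := fun _ => Φ) Ω.isOpen (Ω.isOpen.prod isOpen_univ)
    (fun _ x hx => mk_mem_prod hx (mem_univ _)) (fun _ => hΦ.contDiffOn) fun K hK hKΩ k => ?_
  obtain ⟨N, C, hC⟩ := hΦ.bound K hK hKΩ k
  have h4 : ModerateOn K fun ε x => 1 + ‖u ε x‖ :=
    (moderateOn_const 1).add (hu.moderateOn_norm hK hKΩ)
  exact ((moderateOn_const C).mul (h4.pow (fun _ _ _ => by positivity) N)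
    fun _ _ _ => by positivity).mono fun ε x hx => hC x hx _

/-- The difference is moderate, so order zero suffices. There the mean value inequality on a ball
containing both values bounds it by a moderate factor times `‖u_ε - v_ε‖`. -/
theorem SlowlyIncreasingOn.isNegligible_comp_sub (Ω : TopologicalSpace.Opens (Space p))
    {Φ : Space p × F → F'} (hΦ : SlowlyIncreasingOn Ω Φ) {u v : Param → Space p → F}
    (hu : IsModerate Ω u) (hv : IsModerate Ω v) (huv : IsNegligible (Ω : Set (Space p)) (u - v)) :
    IsNegligible (Ω : Set (Space p)) fun ε x => Φ (x, u ε x) - Φ (x, v ε x) := by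
  refine IsModerate.isNegligible Ω.isOpen ((moderate F' Ω).sub_mem
    (hΦ.isModerate_comp Ω hu) (hΦ.isModerate_comp Ω hv)) fun K hK hKΩ => ?_
  obtain ⟨N, C, hC⟩ := hΦ.bound K hK hKΩ 1
  have hR : ModerateOn K fun ε x => 1 + (‖u ε x‖ + ‖v ε x‖) :=
    (moderateOn_const 1).add ((hu.moderateOn_norm hK hKΩ).add (hv.moderateOn_norm hK hKΩ))
  refine (((moderateOn_const |C|).mul (hR.pow (fun _ _ _ => by positivity) N)
    fun _ _ _ => by positivity).mul_negligibleOn (huv.negligibleOn_norm hK hKΩ)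
      fun _ _ _ => norm_nonneg _).mono fun ε x hx => ?_
  set R := ‖u ε x‖ + ‖v ε x‖ with hRdef
  have hd : ∀ y, DifferentiableAt ℝ Φ (x, y) := fun y =>
    (hΦ.contDiffOn.contDiffAt_of_isOpen (Ω.isOpen.prod isOpen_univ)
      (⟨hKΩ hx, trivial⟩ : (x, y) ∈ (Ω : Set (Space p)) ×ˢ univ) 1).differentiableAt (by norm_num)
  have hinr : ∀ y : F, HasFDerivAt (fun y : F => (x, y))
      (ContinuousLinearMap.inr ℝ (Space p) F) y := fun y => hasFDerivAt_prodMk_right x y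
  have hcomp : ∀ y, HasFDerivAt (fun y => Φ (x, y))
      ((fderiv ℝ Φ (x, y)).comp (ContinuousLinearMap.inr ℝ (Space p) F)) y := fun y =>
    (hd y).hasFDerivAt.comp y (hinr y)
  refine (convex_closedBall (0 : F) R).norm_image_sub_le_of_norm_fderiv_le (𝕜 := ℝ)
    (f := fun y => Φ (x, y)) (fun y _ => (hcomp y).differentiableAt) (fun y hy => ?_) ?_ ?_
  · rw [(hcomp y).fderiv]
    rw [mem_closedBall_zero_iff] at hy
    calc _ ≤ ‖fderiv ℝ Φ (x, y)‖ * ‖ContinuousLinearMap.inr ℝ (Space p) F‖ :=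
          ContinuousLinearMap.opNorm_comp_le _ _
      _ ≤ ‖fderiv ℝ Φ (x, y)‖ * 1 := by
          gcongr
          exact ContinuousLinearMap.norm_inr_le_one ℝ (Space p) F
      _ ≤ C * (1 + ‖y‖) ^ N := by
          rw [mul_one, ← norm_iteratedFDeriv_one]
          exact hC x hx y
      _ ≤ |C| * (1 + R) ^ N := by
          gcongr
          exact le_abs_self C
  · rw [mem_closedBall_zero_iff, hRdef]
    linarith [norm_nonneg (u ε x)]
  · rw [mem_closedBall_zero_iff, hRdef]
    linarith [norm_nonneg (v ε x)]

end Families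


/-! ### Prolongations and differential operators -/

section Congr

variable {p : ℕ} {F : Type*} [NormedAddCommGroup F] [NormedSpace ℝ F] {Ω : Set (Space p)}
  {u v : Param → Space p → F}

theorem IsNegligible.congr (hΩ : IsOpen Ω) (hu : IsNegligible Ω u) (h : ∀ ε, EqOn (v ε) (u ε) Ω) :
    IsNegligible Ω v := by
  refine hu.of_norm_le (fun ε => (hu.1 ε).congr (h ε)) fun k =>
    ⟨1, k, zero_le_one, fun ε x hx => ?_⟩
  rw [one_mul, (((h ε).eventuallyEq_of_mem (hΩ.mem_nhds hx)).iteratedFDeriv ℝ k).eq_of_nhds]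

end Congr

section Prolongation

variable {p q l n : ℕ}

/-- The contribution of the derivatives of order `|α|` to the coordinate `u^j_α` of a jet. -/
def jetCoord (a : Fin q × MultiIndex p n) :
    (Space p [×a.2.directions.length]→L[ℝ] Space q) →L[ℝ] JetSpace p q n :=
  ((EuclideanSpace.proj a.1 : Space q →L[ℝ] ℝ).comp
    (ContinuousMultilinearMap.apply ℝ (fun _ => Space p) (Space q)
      fun k => EuclideanSpace.single (a.2.directions.get k) (1 : ℝ))).smulRight
    (EuclideanSpace.single a (1 : ℝ))

/-- Writing the jet as a finite sum of continuous linear images of iterated derivatives lets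
linearity, moderateness and negligibility be checked termwise. -/
theorem prolong_eq_sum (f : Space p → Space q) (x : Space p) :
    prolong n f x =
      ∑ a : Fin q × MultiIndex p n, jetCoord a (iteratedFDeriv ℝ a.2.directions.length f x) := by
  ext b
  simp [prolong, partialDeriv, jetCoord, Pi.single_apply]

theorem prolong_sub {Ω : Set (Space p)} (hΩ : IsOpen Ω) {f g : Space p → Space q}
    (hf : ContDiffOn ℝ ∞ f Ω) (hg : ContDiffOn ℝ ∞ g Ω) {x : Space p} (hx : x ∈ Ω) :
    prolong n (f - g) x = prolong n f x - prolong n g x := by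
  simp only [prolong_eq_sum, ← Finset.sum_sub_distrib, ← map_sub]
  refine Finset.sum_congr rfl fun a _ => ?_
  rw [iteratedFDeriv_sub_apply (hf.contDiffAt_of_isOpen hΩ hx _)
    (hg.contDiffAt_of_isOpen hΩ hx _)]

variable (Ω : TopologicalSpace.Opens (Space p))

theorem prolong_family_eq_sum (u : Param → Space p → Space q) :
    (fun ε => prolong n (u ε)) = ∑ a : Fin q × MultiIndex p n,
      fun ε => jetCoord a ∘ iteratedFDeriv ℝ a.2.directions.length (u ε) := by
  funext ε x
  simp [prolong_eq_sum]

theorem IsModerate.prolong {u : Param → Space p → Space q} (hu : IsModerate Ω u) :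
    IsModerate (Ω : Set (Space p)) fun ε => prolong n (u ε) := by
  rw [prolong_family_eq_sum]
  exact (moderate _ Ω).sum_mem fun a _ =>
    (hu.iteratedFDeriv Ω.isOpen _).clm_comp (jetCoord a) Ω.isOpen

theorem IsNegligible.prolong {u : Param → Space p → Space q} (hu : IsNegligible Ω u) :
    IsNegligible (Ω : Set (Space p)) fun ε => prolong n (u ε) := by
  rw [prolong_family_eq_sum]
  exact (negligible _ Ω).sum_mem fun a _ =>
    (hu.iteratedFDeriv Ω.isOpen _).clm_comp (jetCoord a) Ω.isOpen

theorem _root_.Function.HasTemperateGrowth.slowlyIncreasingOn {F F' : Type*}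
    [NormedAddCommGroup F] [NormedSpace ℝ F] [NormedAddCommGroup F'] [NormedSpace ℝ F']
    {Φ : Space p × F → F'} (hΦ : Function.HasTemperateGrowth Φ) (Ω : Set (Space p)) :
    SlowlyIncreasingOn Ω Φ := by
  refine ⟨hΦ.1.contDiffOn, fun K hK _ k => ?_⟩
  obtain ⟨N, C, hC⟩ := hΦ.2 k
  obtain ⟨R, hR⟩ := hK.isBounded.exists_norm_le
  refine ⟨N, |C| * (1 + |R|) ^ N, fun x hx y => (hC (x, y)).trans ?_⟩
  rw [mul_assoc, ← mul_pow]
  have h1 : ‖(x, y)‖ ≤ |R| + ‖y‖ :=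
    (norm_prod_le_iff.2 ⟨by linarith [hR x hx, le_abs_self R, norm_nonneg y],
      by linarith [abs_nonneg R]⟩)
  -- On a compact set the base variable contributes only a constant factor to polynomial growth.
  have h2 : 1 + ‖(x, y)‖ ≤ (1 + |R|) * (1 + ‖y‖) := by
    nlinarith [abs_nonneg R, norm_nonneg y, mul_nonneg (abs_nonneg R) (norm_nonneg y)]
  gcongr
  exact le_abs_self C

theorem IsModerate.diffOp {Δ : Space p → JetSpace p q n → Space l}
    (hΔ : Function.HasTemperateGrowth fun z : Space p × JetSpace p q n => Δ z.1 z.2)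
    {u : Param → Space p → Space q} (hu : IsModerate (Ω : Set (Space p)) u) :
    IsModerate (Ω : Set (Space p)) fun ε => diffOp Δ (u ε) :=
  (hΔ.slowlyIncreasingOn (Ω : Set (Space p))).isModerate_comp Ω (hu.prolong Ω)

theorem isNegligible_diffOp_sub {Δ : Space p → JetSpace p q n → Space l}
    (hΔ : Function.HasTemperateGrowth fun z : Space p × JetSpace p q n => Δ z.1 z.2)
    {u v : Param → Space p → Space q} (hu : IsModerate (Ω : Set (Space p)) u)
    (hv : IsModerate (Ω : Set (Space p)) v) (huv : IsNegligible (Ω : Set (Space p)) (u - v)) :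
    IsNegligible (Ω : Set (Space p)) fun ε => diffOp Δ (u ε) - diffOp Δ (v ε) :=
  (hΔ.slowlyIncreasingOn (Ω : Set (Space p))).isNegligible_comp_sub Ω (hu.prolong Ω) (hv.prolong Ω)
    ((huv.prolong Ω).congr Ω.isOpen fun ε _ hx =>
      (prolong_sub Ω.isOpen (hu.1 ε) (hv.1 ε) hx).symm)

end Prolongation

theorem cl_eq_cl_iff {p : ℕ} {F : Type*} [NormedAddCommGroup F] [NormedSpace ℝ F]
    {Ω : TopologicalSpace.Opens (Space p)} {u v : moderate F Ω} :
    cl u = cl v ↔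
      IsNegligible (Ω : Set (Space p)) ((u : Param → Space p → F) - (v : Param → Space p → F)) :=
  Submodule.Quotient.eq _

theorem cl_eq_zero_iff {p : ℕ} {F : Type*} [NormedAddCommGroup F] [NormedSpace ℝ F]
    {Ω : TopologicalSpace.Opens (Space p)} {u : moderate F Ω} :
    cl u = 0 ↔ IsNegligible (Ω : Set (Space p)) (u : Param → Space p → F) :=
  Submodule.Quotient.mk_eq_zero _

/-! ### Solving the linear system with negligible right-hand side -/

section Lifting

variable {p q l n : ℕ} {Ω : TopologicalSpace.Opens (Space p)}

/-- The prolongation at a point, on the level of sequences of derivatives. -/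
def jetsProlong (x : Ω) : smoothJets (Space q) Ω →L[ℝ] JetSpace p q n :=
  ∑ a : Fin q × MultiIndex p n, (jetCoord a).comp
    ((ContinuousMap.evalCLM ℝ x).comp
      ((ContinuousLinearMap.proj (R := ℝ)
        (φ := fun k : ℕ => C(Ω, Space p [×k]→L[ℝ] Space q)) a.2.directions.length).comp
        (smoothJets (Space q) Ω).subtypeL))

/-- Evaluation of a function at a point, on the level of sequences of derivatives. -/
def jetsEval (x : Ω) : smoothJets (Space l) Ω →L[ℝ] Space l :=
  (continuousMultilinearCurryFin0 ℝ (Space p) (Space l) :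
    (Space p [×0]→L[ℝ] Space l) →L[ℝ] Space l).comp
    ((ContinuousMap.evalCLM ℝ x).comp
      ((ContinuousLinearMap.proj (R := ℝ)
        (φ := fun k : ℕ => C(Ω, Space p [×k]→L[ℝ] Space l)) 0).comp
        (smoothJets (Space l) Ω).subtypeL))

theorem jetsProlong_toJets {f : Space p → Space q} (hf : ContDiffOn ℝ ∞ f Ω) (x : Ω) :
    jetsProlong (n := n) x (toJets f hf) = prolong n f x := by
  rw [prolong_eq_sum, jetsProlong, sum_apply]
  rfl

theorem jetsEval_toJets {f : Space p → Space l} (hf : ContDiffOn ℝ ∞ f Ω) (x : Ω) :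
    jetsEval x (toJets f hf) = f x := rfl

theorem exists_eq_toJets {F : Type*} [NormedAddCommGroup F] [NormedSpace ℝ F]
    (g : smoothJets F Ω) : ∃ (f : Space p → F) (hf : ContDiffOn ℝ ∞ f Ω), g = toJets f hf := by
  obtain ⟨g, f, hf, h⟩ := g
  exact ⟨f, hf, Subtype.ext (funext fun k => ContinuousMap.ext fun x => h k x)⟩

/-- The graph of a linear differential operator in `C^∞(Ω)^q × C^∞(Ω)^l`. -/
def diffOpGraph (L : Space p → JetSpace p q n →L[ℝ] Space l) :
    Submodule ℝ (smoothJets (Space q) Ω × smoothJets (Space l) Ω) where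
  carrier := {z | ∀ x : Ω, L x (jetsProlong x z.1) = jetsEval x z.2}
  zero_mem' := fun x => by simp
  add_mem' := fun {a b} ha hb x => by
    simpa only [Prod.fst_add, Prod.snd_add, map_add] using congrArg₂ (· + ·) (ha x) (hb x)
  smul_mem' := fun c a ha x => by
    simpa only [Prod.smul_fst, Prod.smul_snd, map_smul] using congrArg (c • ·) (ha x)

/-- Membership is tested point by point, and each test compares two continuous maps; no regularity
of `L` in `x` is involved. -/
theorem isClosed_diffOpGraph (L : Space p → JetSpace p q n →L[ℝ] Space l) :
    IsClosed (diffOpGraph (Ω := Ω) L : Set (smoothJets (Space q) Ω × smoothJets (Space l) Ω)) := by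
  have : (diffOpGraph (Ω := Ω) L : Set (smoothJets (Space q) Ω × smoothJets (Space l) Ω)) =
      ⋂ x : Ω, {z | L x (jetsProlong x z.1) = jetsEval x z.2} := ofPred_forall _
  rw [this]
  exact isClosed_iInter fun x => isClosed_eq
    ((L x).continuous.comp ((jetsProlong x).continuous.comp continuous_fst))
    ((jetsEval x).continuous.comp continuous_snd)

theorem exists_rapidlyDecreasing_mem_diffOpGraph (L : Space p → JetSpace p q n →L[ℝ] Space l)
    (hsurj : ∀ g : smoothJets (Space l) Ω, ∃ u : smoothJets (Space q) Ω,
      (u, g) ∈ diffOpGraph (Ω := Ω) L)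
    {w : Param → smoothJets (Space l) Ω} (hw : IsRapidlyDecreasing w) :
    ∃ u : Param → smoothJets (Space q) Ω, (∀ ε, (u ε, w ε) ∈ diffOpGraph (Ω := Ω) L) ∧
      IsRapidlyDecreasing u := by
  have h := isClosed_diffOpGraph (Ω := Ω) L
  refine IsRapidlyDecreasing.exists_lift_of_isClosed (X := smoothJets (Space q) Ω)
    (Y := smoothJets (Space l) Ω) (Γ := diffOpGraph (Ω := Ω) L) ?_ ?_ ?_
  · exact h
  · exact hsurj
  · exact hw

/-- A linear differential operator which is onto on smooth functions is onto on negligible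
families. -/
theorem exists_negligible_diffOp_eq {Δ : Space p → JetSpace p q n → Space l}
    (hlin : ∀ x, IsLinearMap ℝ (Δ x))
    (hsurj : ∀ f : Space p → Space l, ContDiffOn ℝ ∞ f Ω →
      ∃ u : Space p → Space q, ContDiffOn ℝ ∞ u Ω ∧ ∀ x ∈ Ω, diffOp Δ u x = f x)
    {w : Param → Space p → Space l} (hw : IsNegligible (Ω : Set (Space p)) w) :
    ∃ m : Param → Space p → Space q, IsNegligible (Ω : Set (Space p)) m ∧
      ∀ ε, ∀ x ∈ Ω, diffOp Δ (m ε) x = w ε x := by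
  let L : Space p → JetSpace p q n →L[ℝ] Space l := fun x =>
    LinearMap.toContinuousLinearMap ((hlin x).mk' (Δ x))
  have hL : ∀ x j, L x j = Δ x j := fun _ _ => rfl
  have hsurj' : ∀ g : smoothJets (Space l) Ω, ∃ u : smoothJets (Space q) Ω,
      (u, g) ∈ diffOpGraph (Ω := Ω) L := by
    intro g
    obtain ⟨f, hf, rfl⟩ := exists_eq_toJets g
    obtain ⟨u, hu, huf⟩ := hsurj f hf
    refine ⟨toJets u hu, fun x => ?_⟩
    rw [jetsProlong_toJets, jetsEval_toJets, hL]
    exact huf x x.2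
  obtain ⟨γ, hγ, hγ'⟩ := exists_rapidlyDecreasing_mem_diffOpGraph L hsurj'
    ((isNegligible_iff_isRapidlyDecreasing hw.1).1 hw)
  choose m hm hγm using fun ε => exists_eq_toJets (γ ε)
  obtain rfl : γ = fun ε => toJets (m ε) (hm ε) := funext hγm
  refine ⟨m, (isNegligible_iff_isRapidlyDecreasing hm).2 hγ', fun ε x hx => ?_⟩
  have h : L x (jetsProlong ⟨x, hx⟩ (toJets (m ε) (hm ε))) =
    jetsEval ⟨x, hx⟩ (toJets (w ε) (hw.1 ε)) := hγ ε ⟨x, hx⟩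
  rwa [jetsProlong_toJets, jetsEval_toJets, hL] at h

end Lifting

/-! ### The group action on families -/

section Action

variable {p q : ℕ} {G : TransformationGroup p q} {η : ℝ}

theorem contDiffOn_act (Ω : TopologicalSpace.Opens (Space p)) (h : G.ActsOver η Ω) :
    ContDiffOn ℝ ∞ (fun z : Space p × Space q => G.Φ η z.1 z.2) ((Ω : Set (Space p)) ×ˢ univ) :=
  (G.smooth.comp (f := fun z : Space p × Space q => (η, z)) (by fun_prop)
    fun z hz => h z.1 hz.1 z.2).snd

theorem slowlyIncreasingOn_act (hslow : G.SlowlyIncreasing) (Ω : TopologicalSpace.Opens (Space p))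
    (h : G.ActsOver η Ω) :
    SlowlyIncreasingOn (Ω : Set (Space p)) fun z : Space p × Space q => G.Φ η z.1 z.2 := by
  refine ⟨contDiffOn_act Ω h, fun K hK hKΩ k => ?_⟩
  obtain ⟨N, C, hC⟩ := hslow η K hK (fun x hx => ⟨0, h x (hKΩ hx) 0⟩) k
  exact ⟨N, C, fun x hx u => hC x hx u (h x (hKΩ hx) u)⟩

theorem Ξ_neg_apply {Ω : Set (Space p)} (h : G.ActsOver η Ω) {x : Space p} (hx : x ∈ Ω) :
    G.Ξ (-η) (G.Ξ η x) = x :=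
  congrArg Prod.fst (G.act_neg (h x hx 0))

theorem mapsTo_Ξ_neg {Ω : Set (Space p)} (h : G.ActsOver η Ω) :
    MapsTo (G.Ξ (-η)) (G.Ξ η '' Ω) Ω := by
  rintro _ ⟨x, hx, rfl⟩
  rwa [Ξ_neg_apply h hx]

/-- Smoothness is known only for the joint action on the open domain. Near `Ξ_η x` the fibre
coordinate is frozen at `Φ_η(x, 0)`, where `g_{-η}` is defined; by projectability `Ξ_{-η}` does not
see this choice. -/
theorem contDiffOn_Ξ_neg {Ω : Set (Space p)} (h : G.ActsOver η Ω) :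
    ContDiffOn ℝ ∞ (G.Ξ (-η)) (G.Ξ η '' Ω) := by
  rintro _ ⟨x, hx, rfl⟩
  have hd := G.neg_mem (h x hx 0)
  have h1 := (G.smooth.contDiffAt (G.isOpen_dom.mem_nhds hd)).comp
    (f := fun y : Space p => (-η, (y, G.Φ η x 0))) (G.Ξ η x) (by fun_prop)
  exact (h1.fst).contDiffWithinAt

theorem isModerate_actFun (hslow : G.SlowlyIncreasing) {Ω : TopologicalSpace.Opens (Space p)}
    (h : G.ActsOver η Ω) {u : Param → Space p → Space q} (hu : IsModerate (Ω : Set (Space p)) u) :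
    IsModerate (G.image h : Set (Space p)) fun ε => G.actFun η (u ε) :=
  ((slowlyIncreasingOn_act hslow Ω h).isModerate_comp Ω hu).comp_smooth Ω.isOpen (G.image h).isOpen
    (contDiffOn_Ξ_neg h) (mapsTo_Ξ_neg h)

theorem isNegligible_actFun_sub (hslow : G.SlowlyIncreasing)
    {Ω : TopologicalSpace.Opens (Space p)} (h : G.ActsOver η Ω) {u v : Param → Space p → Space q}
    (hu : IsModerate (Ω : Set (Space p)) u) (hv : IsModerate (Ω : Set (Space p)) v)
    (huv : IsNegligible (Ω : Set (Space p)) (u - v)) :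
    IsNegligible (G.image h : Set (Space p)) fun ε => G.actFun η (u ε) - G.actFun η (v ε) :=
  ((slowlyIncreasingOn_act hslow Ω h).isNegligible_comp_sub Ω hu hv huv).comp_smooth Ω.isOpen
    (G.image h).isOpen (contDiffOn_Ξ_neg h) (mapsTo_Ξ_neg h)

end Action

/-! ### Classical representatives and the symmetry theorem -/

/-- A solution in `G(Ω)` of a linear system whose operator is onto on smooth functions has a
representative consisting of classical solutions. -/
theorem IsGenSolution.exists_classical_representative {p q l n : ℕ}
    {Ω : TopologicalSpace.Opens (Space p)} {Δ : Space p → JetSpace p q n → Space l}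
    (hlin : ∀ x, IsLinearMap ℝ (Δ x))
    (hsurj : ∀ f : Space p → Space l, ContDiffOn ℝ ∞ f Ω →
      ∃ u : Space p → Space q, ContDiffOn ℝ ∞ u Ω ∧ ∀ x ∈ Ω, diffOp Δ u x = f x)
    {U : GenFun (Space q) Ω} (hU : IsGenSolution Δ U) :
    ∃ u : moderate (Space q) Ω, cl u = U ∧
      ∀ ε, IsClassicalSolution Δ Ω ((u : Param → Space p → Space q) ε) := by
  obtain ⟨v, hv⟩ := Submodule.Quotient.mk_surjective _ U
  obtain ⟨hmod, h0⟩ := hU v hv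
  -- The defect of `v` is reproduced exactly on `Ω` by a negligible `m`, so subtracting `m` removes
  -- it without changing the class.
  obtain ⟨m, hm, hmv⟩ := exists_negligible_diffOp_eq hlin hsurj (cl_eq_zero_iff.1 h0)
  have hvm : (v : Param → Space p → Space q) - m ∈ moderate (Space q) Ω :=
    (moderate (Space q) Ω).sub_mem v.2 (show m ∈ moderate (Space q) Ω from hm.isModerate)
  refine ⟨⟨_, hvm⟩, ?_, fun ε => ⟨hvm.1 ε, fun x hx => ?_⟩⟩
  · rw [← hv]
    refine (cl_eq_cl_iff (u := ⟨_, hvm⟩) (v := v)).2 ?_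
    have e : (v : Param → Space p → Space q) - m - (v : Param → Space p → Space q) = -m := by abel
    change IsNegligible (Ω : Set (Space p)) ((v : Param → Space p → Space q) - m - (v : Param → Space p → Space q))
    rw [e]
    exact (negligible (Space q) Ω).neg_mem (show m ∈ negligible (Space q) Ω from hm)
  · have h := hmv ε x hx
    have e := prolong_sub (n := n) Ω.isOpen (v.2.1 ε) (hm.1 ε) hx
    simp only [diffOp] at h ⊢
    change Δ x (prolong n ((v : Param → Space p → Space q) ε - m ε) x) = 0
    rw [e, (hlin x).map_sub, h, sub_self]

end Colombeau

end

open Colombeau in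
theorem theorem3p11 (p l n : ℕ) (Ω : TopologicalSpace.Opens (Space p))
    (Δ : Space p → JetSpace p l n → Space l)
    (hlin : ∀ x, IsLinearMap ℝ (Δ x))
    (hΔ : Function.HasTemperateGrowth (fun z : Space p × JetSpace p l n => Δ z.1 z.2))
    (hsurj : ∀ f : Space p → Space l, ContDiffOn ℝ ∞ f Ω →
      ∃ u : Space p → Space l, ContDiffOn ℝ ∞ u Ω ∧ ∀ x ∈ Ω, diffOp Δ u x = f x)
    (G : TransformationGroup p l)
    (hslow : G.SlowlyIncreasing)
    (hsym : G.IsClassicalSymmetryGroup Δ) :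
    G.IsGenSymmetryGroup Δ Ω := by
  intro η h U hU
  obtain ⟨u, hu, hsol⟩ := hU.exists_classical_representative hlin hsurj
  have hmod := isModerate_actFun hslow h u.2
  refine ⟨cl ⟨_, hmod⟩, fun v hv => ?_, fun v hv => ?_⟩
  · exact ⟨isModerate_actFun hslow h v.2, cl_eq_cl_iff.2
      (isNegligible_actFun_sub hslow h v.2 u.2 (cl_eq_cl_iff.1 (hv.trans hu.symm)))⟩
  -- Here `v` is an arbitrary representative of the transformed class. The transform of the
  -- classical representative solves the system exactly, so on `Ξ_η(Ω)` the defect of `v` equals the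
  -- difference of the two defects, which is negligible.
  · refine ⟨IsModerate.diffOp _ hΔ v.2, cl_eq_zero_iff.2 ?_⟩
    refine (isNegligible_diffOp_sub _ hΔ v.2 hmod (cl_eq_cl_iff.1 hv)).congr (G.image h).isOpen
      fun ε x hx => ?_
    have := (hsym η Ω _ Ω.isOpen (hsol ε) fun x hx => h x hx _).2 x hx
    simp [this]
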